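/- Let $V$ be a measurable real function on $(-1,1)$ with $V(x)\ge 0$ and $(1-x^2)V(x)\le M<\infty$ for a.e. $x\in(-1,1)$. Let $\widetilde L_2(-1,1)$ be the space of complex measurable functions $u$ on $(-1,1)$ with $\int_{-1}^1 \frac{|u(x)|^2}{1-x^2}\,dx<\infty$, and for $u\in\widetilde L_2(-1,1)$ let $$U(\xi)=\mathcal P[u](\xi)=\int_{-1}^1 u(y)\Bigl(\frac{1-y}{1+y}\Bigr)^{i\xi}\frac{dy}{1-y^2},\qquad \xi\in\mathbb R,$$ understood, like the Fourier transform on $L_2(\mathbb R)$, as the continuous extension to $\widetilde L_2(-1,1)$ from the functions for which the integral converges absolutely. For $s\ge 0$ let $\widetilde H^s$ be the space of $u\in\widetilde L_2(-1,1)$ with $$\|u\|_{\widetilde H^s}^2=\frac1\pi\int_{-\infty}^{\infty}(1+4\xi^2)^s|U(\xi)|^2\,d\xi<\infty,$$ and let $(\widetilde H^s)^*$ be its dual with respect to the pairing in $L_2(-1,1)$, that is, the space of bounded anti-linear functionals $u\mapsto (f,u)$ on $\widetilde H^s$ (a function $f$ is identified with $u\mapsto\int_{-1}^1 f\bar u\,dx$),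 with the norm $\|f\|_{(\widetilde H^s)^*}=\sup_{0\ne u\in\widetilde H^s}|(f,u)|/\|u\|_{\widetilde H^s}$. For $s\le t$, $(\widetilde H^s)^*\subset(\widetilde H^t)^*$ by restricting the functional from $\widetilde H^s$ to $\widetilde H^t\subset\widetilde H^s$. For $f\in(\widetilde H^{1/2})^*$, a weak solution of the Prandtl problem $$V(x)u(x)-\frac1{2\pi}\int_{-1}^1\frac{u'(t)}{t-x}\,dt=f(x),\qquad u(-1)=u(1)=0,$$ is an element $u\in\widetilde H^{1/2}$ such that, for all $g\in\widetilde H^{1/2}$ with $G=\mathcal P[g]$, $$\int_{-1}^1 V(x)u(x)\overline{g(x)}\,dx+\frac1\pi\int_{-\infty}^\infty \xi\coth(\pi\xi)\,U(\xi)\overline{G(\xi)}\,d\xi=(f,g).$$ **Theorem.** Let $0\le\theta\le 1/2$ and $f\in(\widetilde H^{1/2-\theta})^*$ ($\subset(\widetilde H^{1/2})^*$). Then the weak solution $u$ exists and is unique, it belongs to $\widetilde H^{1/2+\theta}$, and $$\|u\|_{\widetilde H^{1/2+\theta}}\le \pi^{1-2\theta}\,C_2^{\theta}\,\|f\|_{(\widetilde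 H^{1/2-\theta})^*},\qquad C_2=\pi^2\Bigl(2+\frac{\pi}{2}M\Bigr).$$ -/

import Mathlib

open MeasureTheory Set
open scoped FourierTransform ComplexConjugate ENNReal

noncomputable section

namespace Prandtl

/-! ### The space `L̃₂(-1,1)` -/

/-- The measure `dx / (1 - x²)` on the interval `(-1,1)`. -/
def muTilde : Measure ℝ :=
  (volume.restrict (Ioo (-1 : ℝ) 1)).withDensity fun x => ENNReal.ofReal (1 / (1 - x ^ 2))

/-- The Hilbert space `L̃₂(-1,1)` of complex functions with
`‖u‖² = ∫_{-1}^1 |u(x)|² / (1 - x²) dx < ∞`. -/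
abbrev LTilde : Type := Lp ℂ 2 muTilde

/-! ### The change of variable `x = -tanh ω`, i.e. `ω = (1/2) ln ((1 - x) / (1 + x))` -/

/-- The substitution `x = -tanh ω`. -/
def subst (ω : ℝ) : ℝ := -Real.tanh ω

theorem hasDerivAt_subst (ω : ℝ) : HasDerivAt subst (-(1 / Real.cosh ω ^ 2)) ω := by
  have hc : Real.cosh ω ≠ 0 := (Real.cosh_pos ω).ne'
  have h := ((Real.hasDerivAt_sinh ω).div (Real.hasDerivAt_cosh ω) hc).neg
  have e : subst = -(Real.sinh / Real.cosh) := by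
    funext x
    simp [subst, Real.tanh_eq_sinh_div_cosh]
  rw [e]
  have e' : Real.cosh ω * Real.cosh ω - Real.sinh ω * Real.sinh ω = 1 := by
    linarith [Real.cosh_sq ω, sq (Real.cosh ω), sq (Real.sinh ω)]
  rw [e'] at h
  exact h

theorem continuous_subst : Continuous subst :=
  continuous_iff_continuousAt.2 fun ω => (hasDerivAt_subst ω).continuousAt

theorem injective_subst : Function.Injective subst := fun _ _ h =>
  Real.tanh_injective (neg_injective h)

theorem subst_mem (ω : ℝ) : subst ω ∈ Ioo (-1 : ℝ) 1 :=
  ⟨neg_lt_neg (Real.tanh_lt_one ω), by simpa [subst] using neg_lt_neg (Real.neg_one_lt_tanh ω)⟩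

theorem one_sub_subst_sq (ω : ℝ) : 1 - subst ω ^ 2 = 1 / Real.cosh ω ^ 2 := by
  have hc : Real.cosh ω ≠ 0 := (Real.cosh_pos ω).ne'
  rw [subst, neg_sq, Real.tanh_eq_sinh_div_cosh]
  field_simp
  linarith [Real.cosh_sq ω]

theorem image_subst (s : Set ℝ) : subst '' (subst ⁻¹' s) = s ∩ Ioo (-1 : ℝ) 1 := by
  ext x
  constructor
  · rintro ⟨ω, hω, rfl⟩
    exact ⟨hω, subst_mem ω⟩
  · rintro ⟨hx, hx'⟩
    have e : subst (Real.artanh (-x)) = x := by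
      rw [subst, Real.tanh_artanh (by constructor <;> linarith [hx'.1, hx'.2]), neg_neg]
    exact ⟨Real.artanh (-x), by simpa [e] using hx, e⟩

/-- The substitution `x = -tanh ω` takes `dω` to `dx / (1 - x²)`. -/
theorem measurePreserving_subst : MeasurePreserving subst volume muTilde := by
  refine ⟨continuous_subst.measurable, ?_⟩
  ext s hs
  have hs' : MeasurableSet (subst ⁻¹' s) := continuous_subst.measurable hs
  rw [Measure.map_apply continuous_subst.measurable hs, muTilde, withDensity_apply _ hs,
    Measure.restrict_restrict hs, ← image_subst s,
    lintegral_image_eq_lintegral_abs_deriv_mul hs'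
      (fun x _ => (hasDerivAt_subst x).hasDerivWithinAt) injective_subst.injOn]
  have : ∀ ω, ENNReal.ofReal |-(1 / Real.cosh ω ^ 2)|
      * ENNReal.ofReal (1 / (1 - subst ω ^ 2)) = 1 := by
    intro ω
    have hc : 0 < Real.cosh ω := Real.cosh_pos ω
    rw [one_sub_subst_sq, abs_neg, abs_of_pos (by positivity),
      ← ENNReal.ofReal_mul (by positivity)]
    have : 1 / Real.cosh ω ^ 2 * (1 / (1 / Real.cosh ω ^ 2)) = 1 := by
      field_simp
    rw [this, ENNReal.ofReal_one]
  simp only [this, setLIntegral_one]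

/-! ### The integral transform `𝒫` -/

/-- The isometry `A : L̃₂(-1,1) → L₂(ℝ)`, `(A u)(ω) = u(-tanh ω)`. -/
def mapA : LTilde →ₗᵢ[ℂ] Lp ℂ 2 (volume : Measure ℝ) :=
  Lp.compMeasurePreservingₗᵢ ℂ subst measurePreserving_subst

/-- The transform `𝒫[u](ξ) = ∫_{-1}^1 u(y) ((1-y)/(1+y))^{iξ} dy/(1-y²)` on `L̃₂(-1,1)`.
As for the Fourier transform on `L₂(ℝ)`, the integral need not converge absolutely; the transform is
`𝒫[u](ξ) = ∫_ℝ (A u)(ω) e^{2iξω} dω`, the `L₂` Fourier transform of `A u` (with Mathlib's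
normalization `𝓕 v (η) = ∫ e^{-2πiηω} v(ω) dω`) at the point `η = -ξ/π`.
See `pTransform_eq_integral` for the formula when the integral converges absolutely. -/
def pTransform (u : LTilde) (ξ : ℝ) : ℂ :=
  (𝓕 (mapA u) : Lp ℂ 2 (volume : Measure ℝ)) (-(ξ / Real.pi))

theorem quasi : Measure.QuasiMeasurePreserving (fun ξ : ℝ => -(ξ / Real.pi)) volume volume := by
  have h : (fun ξ : ℝ => -(ξ / Real.pi)) = fun ξ => (-(1 / Real.pi)) * ξ := by
    funext ξ; ring
  rw [h]
  refine ⟨by fun_prop, ?_⟩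
  rw [Real.map_volume_mul_left (neg_ne_zero.2 (one_div_pos.2 Real.pi_pos).ne')]
  exact Measure.smul_absolutelyContinuous

theorem aestronglyMeasurable_pTransform (u : LTilde) :
    AEStronglyMeasurable (pTransform u) volume :=
  (Lp.aestronglyMeasurable _).comp_quasiMeasurePreserving quasi

theorem pTransform_add (u v : LTilde) :
    pTransform (u + v) =ᵐ[volume] fun ξ => pTransform u ξ + pTransform v ξ := by
  have h := quasi.ae (Lp.coeFn_add (𝓕 (mapA u)) (𝓕 (mapA v)))
  filter_upwards [h] with ξ hξ
  simpa [pTransform, FourierAdd.fourier_add] using hξ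

theorem pTransform_smul (c : ℂ) (u : LTilde) :
    pTransform (c • u) =ᵐ[volume] fun ξ => c * pTransform u ξ := by
  have h := quasi.ae (Lp.coeFn_smul c (𝓕 (mapA u)))
  filter_upwards [h] with ξ hξ
  simpa [pTransform, FourierSMul.fourier_smul] using hξ

theorem pTransform_zero : pTransform 0 =ᵐ[volume] fun _ => 0 := by
  simpa using pTransform_smul 0 0

/-- On `L¹ ∩ L²` the `L²` Fourier transform is given by the integral. -/
theorem fourier_L2_eq (v : Lp ℂ 2 (volume : Measure ℝ)) (hv : Integrable v volume) :
    (𝓕 v : Lp ℂ 2 (volume : Measure ℝ)) =ᵐ[volume] 𝓕 (v : ℝ → ℂ) := by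
  have hcont : Continuous (𝓕 (v : ℝ → ℂ)) :=
    VectorFourier.fourierIntegral_continuous Real.continuous_fourierChar
      (by fun_prop) hv
  refine ae_eq_of_integral_contDiff_smul_eq
    ((Lp.memLp _).locallyIntegrable (by norm_num)) hcont.locallyIntegrable ?_
  intro g hg hgc
  have hgC : ContDiff ℝ ((⊤ : ℕ∞) : WithTop ℕ∞) fun x => (g x : ℂ) :=
    Complex.ofRealCLM.contDiff.comp hg
  have hgCc : HasCompactSupport fun x => (g x : ℂ) := hgc.comp_left Complex.ofReal_zero
  let φ : SchwartzMap ℝ ℂ := hgCc.toSchwartzMap hgC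
  have h1 := congrArg (fun T => T φ) (Lp.fourier_toTemperedDistribution_eq v)
  simp only [TemperedDistribution.fourier_apply, Lp.toTemperedDistribution_apply] at h1
  have h2 : ∫ ξ, 𝓕 (φ : ℝ → ℂ) ξ • v ξ = ∫ x, φ x • 𝓕 (v : ℝ → ℂ) x := by
    have := VectorFourier.integral_fourierIntegral_smul_eq_flip (L := innerₗ ℝ)
      (μ := volume) (ν := volume) Real.continuous_fourierChar (by fun_prop)
      (φ.integrable (μ := volume)) hv
    simpa using! this
  have h3 : ∫ x, φ x • (𝓕 v : Lp ℂ 2 (volume : Measure ℝ)) x = ∫ x, φ x • 𝓕 (v : ℝ → ℂ) x := by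
    rw [← h1, ← h2, SchwartzMap.fourier_coe]
  simpa [φ] using h3

theorem measurableEmbedding_subst : MeasurableEmbedding subst :=
  continuous_subst.measurableEmbedding injective_subst

/-- The integral formula for `𝒫`, valid for `u ∈ L̃₁(-1,1) ∩ L̃₂(-1,1)`. -/
theorem pTransform_eq_integral (u : LTilde) (hu : Integrable u muTilde) :
    pTransform u =ᵐ[volume] fun ξ => ∫ y in Ioo (-1 : ℝ) 1,
      u y * (((1 - y) / (1 + y) : ℝ) : ℂ) ^ (Complex.I * ξ) / ((1 - y ^ 2 : ℝ) : ℂ) := by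
  have hA : (mapA u : ℝ → ℂ) =ᵐ[volume] (u : ℝ → ℂ) ∘ subst :=
    Lp.coeFn_compMeasurePreserving u measurePreserving_subst
  have hAi : Integrable (mapA u) volume :=
    ((measurePreserving_subst.integrable_comp_emb measurableEmbedding_subst).2 hu).congr hA.symm
  filter_upwards [quasi.ae (fourier_L2_eq (mapA u) hAi)] with ξ hξ
  rw [pTransform, hξ, Real.fourier_real_eq_integral_exp_smul, ← univ_inter (Ioo (-1 : ℝ) 1),
    ← image_subst univ, preimage_univ,
    integral_image_eq_integral_abs_deriv_smul MeasurableSet.univ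
      (fun x _ => (hasDerivAt_subst x).hasDerivWithinAt) injective_subst.injOn, setIntegral_univ]
  refine integral_congr_ae ?_
  filter_upwards [hA] with ω hω
  have hc : 0 < Real.cosh ω := Real.cosh_pos ω
  have hcC : Complex.cosh (ω : ℂ) ≠ 0 := by
    rw [← Complex.ofReal_cosh]
    exact Complex.ofReal_ne_zero.2 hc.ne'
  have h1 : (1 - subst ω) / (1 + subst ω) = Real.exp (2 * ω) := by
    have := subst_mem ω
    have hp : (0 : ℝ) < 1 + subst ω := by linarith [this.1]
    rw [div_eq_iff hp.ne', subst, Real.tanh_eq_sinh_div_cosh, Real.sinh_eq, Real.cosh_eq, two_mul,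
      Real.exp_add, Real.exp_neg]
    have := Real.exp_pos ω
    field_simp
    ring
  have h2 : ((Real.exp (2 * ω) : ℝ) : ℂ) ^ (Complex.I * ξ) = Complex.exp (2 * ω * Complex.I * ξ) := by
    rw [Complex.ofReal_exp, Complex.cpow_def_of_ne_zero (Complex.exp_ne_zero _),
      ← Complex.ofReal_exp, ← Complex.ofReal_log (Real.exp_pos _).le, Real.log_exp]
    push_cast
    ring_nf
  have h3 : (-2 * Real.pi * ω * (-(ξ / Real.pi)) : ℝ) = 2 * ω * ξ := by
    field_simp
  rw [h1, h2, one_sub_subst_sq, abs_neg, abs_of_pos (by positivity), hω, h3]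
  simp only [Function.comp_apply, smul_eq_mul, Complex.real_smul]
  push_cast
  field_simp

/-! ### The spaces `H̃^s(-1,1)` and their duals -/

theorem weight_pos (s ξ : ℝ) : 0 < (1 + 4 * ξ ^ 2) ^ s := Real.rpow_pos_of_pos (by positivity) s

theorem continuous_weight (s : ℝ) : Continuous fun ξ : ℝ => (1 + 4 * ξ ^ 2) ^ s :=
  Continuous.rpow_const (by fun_prop) fun ξ => Or.inl (by positivity)

/-- The space `H̃^s(-1,1)`, `s ≥ 0`: all `u ∈ L̃₂(-1,1)` with
`∫_ℝ (1 + 4ξ²)^s |U(ξ)|² dξ < ∞`, where `U = 𝒫[u]`. -/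
def HTilde (s : ℝ) : Submodule ℂ LTilde where
  carrier := {u | Integrable (fun ξ : ℝ => (1 + 4 * ξ ^ 2) ^ s * ‖pTransform u ξ‖ ^ 2) volume}
  zero_mem' := by
    refine (integrable_zero ℝ ℝ volume).congr ?_
    filter_upwards [pTransform_zero] with ξ hξ
    simp [hξ]
  add_mem' := by
    intro u v hu hv
    refine ((hu.add hv).const_mul 2).mono'
      ((continuous_weight s).aestronglyMeasurable.mul
        ((aestronglyMeasurable_pTransform _).norm.pow 2)) ?_
    filter_upwards [pTransform_add u v] with ξ hξ
    have hw := weight_pos s ξ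
    rw [hξ, Real.norm_of_nonneg (by positivity)]
    simp only [Pi.add_apply]
    have h1 : ‖pTransform u ξ + pTransform v ξ‖ ^ 2
        ≤ 2 * (‖pTransform u ξ‖ ^ 2 + ‖pTransform v ξ‖ ^ 2) := by
      have := norm_add_le (pTransform u ξ) (pTransform v ξ)
      have h0 := norm_nonneg (pTransform u ξ + pTransform v ξ)
      nlinarith [sq_nonneg (‖pTransform u ξ‖ - ‖pTransform v ξ‖)]
    nlinarith [mul_le_mul_of_nonneg_left h1 hw.le]
  smul_mem' := by
    intro c u hu
    refine (Integrable.const_mul hu (‖c‖ ^ 2)).congr ?_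
    filter_upwards [pTransform_smul c u] with ξ hξ
    rw [hξ, norm_mul]
    ring

/-- The norm `‖u‖_{H̃^s} = ((1/π) ∫_ℝ (1 + 4ξ²)^s |U(ξ)|² dξ)^{1/2}` of `u ∈ H̃^s(-1,1)`. -/
def normHTilde (s : ℝ) (u : LTilde) : ℝ :=
  Real.sqrt (1 / Real.pi * ∫ ξ : ℝ, (1 + 4 * ξ ^ 2) ^ s * ‖pTransform u ξ‖ ^ 2)

/-- `H̃^t ⊂ H̃^s` for `s ≤ t`. -/
theorem HTilde_anti {s t : ℝ} (h : s ≤ t) : HTilde t ≤ HTilde s := by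
  intro u hu
  refine Integrable.mono' hu ((continuous_weight s).aestronglyMeasurable.mul
        ((aestronglyMeasurable_pTransform _).norm.pow 2)) ?_
  refine Filter.Eventually.of_forall fun ξ => ?_
  have hw := weight_pos s ξ
  rw [Real.norm_of_nonneg (by positivity)]
  gcongr
  nlinarith [sq_nonneg ξ]

/-- An anti-linear functional `f` on `H̃^s` belongs to the dual space `(H̃^s)^*` if it is bounded.
The value `f u` is the pairing `(f,u)`; a function `f` on `(-1,1)` is identified with the functional
`u ↦ ∫_{-1}^1 f(x) conj (u(x)) dx`. -/
def MemDual {s : ℝ} (f : HTilde s →ₗ⋆[ℂ] ℂ) : Prop :=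
  ∃ C : ℝ, ∀ u : HTilde s, ‖f u‖ ≤ C * normHTilde s u

/-- The dual norm `‖f‖_{(H̃^s)^*} = sup_{0 ≠ u ∈ H̃^s} |(f,u)| / ‖u‖_{H̃^s}`. -/
def dualNorm {s : ℝ} (f : HTilde s →ₗ⋆[ℂ] ℂ) : ℝ :=
  sSup {r : ℝ | ∃ u : HTilde s, u ≠ 0 ∧ r = ‖f u‖ / normHTilde s u}

/-- The embedding `(H̃^s)^* ⊂ (H̃^t)^*` for `s ≤ t`: the restriction of the pairing to `H̃^t ⊂ H̃^s`. -/
def restrictDual {s t : ℝ} (h : s ≤ t) (f : HTilde s →ₗ⋆[ℂ] ℂ) : HTilde t →ₗ⋆[ℂ] ℂ :=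
  f.comp (Submodule.inclusion (HTilde_anti h))

/-! ### The weak solution -/

/-- `ξ coth (πξ)` (the value at the single point `ξ = 0` is immaterial). -/
def xiCoth (ξ : ℝ) : ℝ := ξ * (Real.cosh (Real.pi * ξ) / Real.sinh (Real.pi * ξ))

/-- The sesquilinear form
`[u,g]₁ = ∫_{-1}^1 V u conj(g) dx + (1/π) ∫_ℝ ξ coth(πξ) U(ξ) conj(G(ξ)) dξ`. -/
def form (V : ℝ → ℝ) (u g : LTilde) : ℂ :=
  (∫ x in Ioo (-1 : ℝ) 1, (V x : ℂ) * u x * conj (g x)) +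
    ((1 / Real.pi : ℝ) : ℂ) * ∫ ξ : ℝ, (xiCoth ξ : ℂ) * pTransform u ξ * conj (pTransform g ξ)

/-- `u` is the weak solution of `V u - (1/2π) ∫_{-1}^1 u'(t)/(t-x) dt = f`, `u(±1) = 0`, for
`f ∈ (H̃^{1/2})^*`: `u ∈ H̃^{1/2}` and `[u,g]₁ = (f,g)` for all `g ∈ H̃^{1/2}`. -/
def IsWeakSolution (V : ℝ → ℝ) (f : HTilde (1 / 2) →ₗ⋆[ℂ] ℂ) (u : LTilde) : Prop :=
  u ∈ HTilde (1 / 2) ∧ ∀ g : HTilde (1 / 2), form V u g = f g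

/-- The constant `C₂ = π² (2 + (π/2) M)`. -/
def constC2 (M : ℝ) : ℝ := Real.pi ^ 2 * (2 + Real.pi / 2 * M)

end Prandtl

end

/-!
After the substitution `x = -tanh ω` and the Fourier transform, `L̃₂(-1,1)` becomes `L₂(ℝ)` and
`H̃^s` becomes the weighted space `L₂((1 + 4ξ²)^s dξ)`. The form `[u,g]₁` becomes multiplication by
the symbol `ξ coth(πξ)` plus a bounded operator `N`, unitarily equivalent to multiplication by
`(1 - x²) V ∈ [0, M]`, so that `N ≥ 0` and `‖N u‖² ≤ M ⟨N u, u⟩`.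

Since `ξ coth(πξ) ≥ π⁻¹ (1 + 4ξ²)^{1/2}` (`le_xiCoth`), the form is coercive on `H̃^{1/2}` with
constant `π⁻¹`, which gives existence, uniqueness and the estimate with constant `π` for `θ = 0`.
If `f ∈ L̃₂` (`θ = 1/2`), the equation reads `ξ coth(πξ) u = f - N u` on the Fourier side, so
`‖u‖²` in `H̃^1` is at most `π² ‖f - N u‖² ≤ 2π² (‖f‖² + ‖N u‖²)`. The energy identity gives
`‖N u‖² ≤ M ⟨N u, u⟩ ≤ M (‖f‖ ‖u‖ - ‖u‖²/π) ≤ π M ‖f‖² / 4`, and the constant is `C₂`.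

Between the two endpoints the solution operator is interpolated by the quadratic `K`-method
(`lintegral_rpow_mul_enorm_sq_le`). For weighted `L₂` spaces the optimal splitting of the data is
explicit, and the resulting one-parameter family of inequalities, integrated against `t^{-α-1} dt`
with `α = 2θ`, gives the intermediate estimate with the exact constant `π^{1-2θ} C₂^θ`. The same
inequality shows `u ∈ H̃^{1/2+θ}`.
-/

noncomputable section

namespace Prandtl

/-! ### Multiplication operators on `L²` -/

section General

variable {X : Type*} [MeasurableSpace X] {μ : Measure X}

/-- Multiplication by a bounded real function `m`, as an operator on `L²`. -/
def mulL (m : X → ℝ) (hm : MemLp (fun x => (m x : ℂ)) ∞ μ) : Lp ℂ 2 μ →L[ℂ] Lp ℂ 2 μ :=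
  (ContinuousLinearMap.mul ℂ ℂ).holderL μ ∞ 2 2 hm.toLp

theorem coeFn_mulL {m : X → ℝ} (hm : MemLp (fun x => (m x : ℂ)) ∞ μ) (u : Lp ℂ 2 μ) :
    mulL m hm u =ᵐ[μ] fun x => (m x : ℂ) * u x := by
  have h := (ContinuousLinearMap.mul ℂ ℂ).coeFn_holder (r := 2) hm.toLp u
  filter_upwards [h, hm.coeFn_toLp] with x hx hx'
  rw [← hx']
  exact hx

theorem memLp_top_ofReal {m : X → ℝ} (hm : AEMeasurable m μ) {C : ℝ}
    (hC : ∀ᵐ x ∂μ, |m x| ≤ C) : MemLp (fun x => (m x : ℂ)) ∞ μ :=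
  memLp_top_of_bound (Complex.measurable_ofReal.comp_aemeasurable hm).aestronglyMeasurable C
    (by simpa using hC)

theorem enorm_sq_eq_lintegral (u : Lp ℂ 2 μ) : ‖u‖ₑ ^ 2 = ∫⁻ x, ‖u x‖ₑ ^ 2 ∂μ := by
  have := eLpNorm_nnreal_pow_eq_lintegral (p := 2) (μ := μ) (f := u) (by norm_num)
  rw [Lp.enorm_def]
  simpa using this

theorem ofReal_norm_sq_eq_lintegral (u : Lp ℂ 2 μ) :
    ENNReal.ofReal (‖u‖ ^ 2) = ∫⁻ x, ‖u x‖ₑ ^ 2 ∂μ := by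
  rw [← enorm_sq_eq_lintegral, ENNReal.ofReal_pow (norm_nonneg _), ofReal_norm]

theorem enorm_mul_ofReal_sq (c : ℝ) (z : ℂ) :
    ‖(c : ℂ) * z‖ₑ ^ 2 = ENNReal.ofReal (c ^ 2) * ‖z‖ₑ ^ 2 := by
  rw [enorm_mul, mul_pow, ← sq_abs, ENNReal.ofReal_pow (abs_nonneg _), ← ofReal_norm]
  simp

/-! ### The Mellin integral behind the interpolation -/

theorem integrableOn_mellin {α : ℝ} (h0 : 0 < α) (h1 : α < 1) :
    IntegrableOn (fun t : ℝ => t ^ (-α - 1) * (t / (1 + t))) (Ioi 0) := by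
  have hm : AEStronglyMeasurable (fun t : ℝ => t ^ (-α - 1) * (t / (1 + t))) volume :=
    (by fun_prop : Measurable _).aestronglyMeasurable
  rw [← Ioc_union_Ioi_eq_Ioi (zero_le_one' ℝ)]
  refine IntegrableOn.union ?_ ?_
  · have := (intervalIntegral.intervalIntegrable_rpow' (a := 0) (b := 1) (r := -α)
      (by linarith)).1
    refine Integrable.mono' this hm.restrict ?_
    filter_upwards [ae_restrict_mem measurableSet_Ioc] with t ht
    have ht0 : 0 < t := ht.1
    rw [Real.norm_of_nonneg (by positivity), Real.rpow_sub_one ht0.ne']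
    have : t ^ (-α) / t * (t / (1 + t)) = t ^ (-α) / (1 + t) := by field_simp
    rw [this]
    exact div_le_self (by positivity) (by linarith)
  · have := integrableOn_Ioi_rpow_of_lt (a := -α - 1) (c := 1) (by linarith) one_pos
    refine Integrable.mono' this hm.restrict ?_
    filter_upwards [ae_restrict_mem measurableSet_Ioi] with t ht
    have ht0 : 0 < t := one_pos.trans ht
    rw [Real.norm_of_nonneg (by positivity)]
    exact mul_le_of_le_one_right (by positivity) (by rw [div_le_one (by positivity)]; linarith)

/-- The constant `∫₀^∞ t^{-α-1} t/(1+t) dt`. -/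
def mellinConst (α : ℝ) : ℝ := ∫ t in Ioi (0 : ℝ), t ^ (-α - 1) * (t / (1 + t))

theorem mellinConst_pos {α : ℝ} (h0 : 0 < α) (h1 : α < 1) : 0 < mellinConst α := by
  rw [mellinConst, setIntegral_pos_iff_support_of_nonneg_ae _ (integrableOn_mellin h0 h1)]
  · refine lt_of_lt_of_le (b := volume (Ioi (0 : ℝ))) (by simp) (measure_mono fun t ht => ?_)
    have ht0 : (0 : ℝ) < t := ht
    exact ⟨(by positivity : (0 : ℝ) < t ^ (-α - 1) * (t / (1 + t))).ne', ht⟩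
  · filter_upwards [ae_restrict_mem measurableSet_Ioi] with t ht
    have ht0 : (0 : ℝ) < t := ht
    simp only [Pi.zero_apply]
    positivity

theorem lintegral_mellin {α x : ℝ} (h0 : 0 < α) (h1 : α < 1) (hx : 0 < x) :
    ∫⁻ t in Ioi (0 : ℝ), ENNReal.ofReal (t ^ (-α - 1) * (x * t / (1 + x * t)))
      = ENNReal.ofReal (x ^ α * mellinConst α) := by
  have hi := (integrableOn_Ioi_comp_mul_left_iff
    (fun t : ℝ => t ^ (-α - 1) * (t / (1 + t))) 0 hx).2 (by simpa using integrableOn_mellin h0 h1)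
  have he := integral_comp_mul_left_Ioi (fun t : ℝ => t ^ (-α - 1) * (t / (1 + t))) 0 hx
  rw [mul_zero] at he
  have key : ∀ t ∈ Ioi (0 : ℝ), t ^ (-α - 1) * (x * t / (1 + x * t))
      = x ^ (α + 1) * ((x * t) ^ (-α - 1) * (x * t / (1 + x * t))) := by
    intro t ht
    have ht0 : (0 : ℝ) < t := ht
    rw [Real.mul_rpow hx.le ht0.le]
    have : x ^ (α + 1) * x ^ (-α - 1) = 1 := by
      rw [← Real.rpow_add hx]; simp
    linear_combination (-(t ^ (-α - 1) * (x * t / (1 + x * t)))) * this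
  rw [← ofReal_integral_eq_lintegral_ofReal]
  · rw [setIntegral_congr_fun measurableSet_Ioi key, integral_const_mul, he, smul_eq_mul,
      ← mul_assoc, Real.rpow_add_one hx.ne', mellinConst]
    congr 2
    field_simp
  · exact IntegrableOn.congr_fun (hi.const_mul (x ^ (α + 1))) (fun t ht => (key t ht).symm)
      measurableSet_Ioi
  · filter_upwards [ae_restrict_mem measurableSet_Ioi] with t ht
    have ht0 : (0 : ℝ) < t := ht
    simp only [Pi.zero_apply]
    positivity

/-- Integrating the kernel `c r t / (1 + c r t)` against `t^{-α-1} dt` produces the weight `r^α`. -/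
theorem lintegral_lintegral_mellin [SFinite μ] {r : X → ℝ} (hr : Measurable r)
    (hr0 : ∀ x, 0 < r x) {α : ℝ} (h0 : 0 < α) (h1 : α < 1) {c : ℝ} (hc : 0 < c) (u : Lp ℂ 2 μ) :
    ∫⁻ t in Ioi (0 : ℝ), ENNReal.ofReal (t ^ (-α - 1)) *
        ∫⁻ x, ENNReal.ofReal (c * r x * t / (1 + c * r x * t)) * ‖u x‖ₑ ^ 2 ∂μ
      = ENNReal.ofReal (c ^ α * mellinConst α) *
        ∫⁻ x, ENNReal.ofReal (r x ^ α) * ‖u x‖ₑ ^ 2 ∂μ := by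
  have hu : Measurable u := (Lp.stronglyMeasurable u).measurable
  calc _ = ∫⁻ t in Ioi (0 : ℝ), ∫⁻ x, ENNReal.ofReal (t ^ (-α - 1)) *
        (ENNReal.ofReal (c * r x * t / (1 + c * r x * t)) * ‖u x‖ₑ ^ 2) ∂μ := by
        refine lintegral_congr fun t => ?_
        rw [lintegral_const_mul]
        fun_prop
    _ = ∫⁻ x, (∫⁻ t in Ioi (0 : ℝ), ENNReal.ofReal (t ^ (-α - 1)) *
        (ENNReal.ofReal (c * r x * t / (1 + c * r x * t)) * ‖u x‖ₑ ^ 2)) ∂μ := by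
        refine lintegral_lintegral_swap (Measurable.aemeasurable ?_)
        fun_prop
    _ = ∫⁻ x, ENNReal.ofReal (c ^ α * mellinConst α) *
          (ENNReal.ofReal (r x ^ α) * ‖u x‖ₑ ^ 2) ∂μ := by
        refine lintegral_congr fun x => ?_
        have hx := hr0 x
        rw [← mul_assoc, ← ENNReal.ofReal_mul
          (mul_nonneg (by positivity) (mellinConst_pos h0 h1).le)]
        have : c ^ α * mellinConst α * r x ^ α = (c * r x) ^ α * mellinConst α := by
          rw [Real.mul_rpow hc.le hx.le]; ring
        rw [this, ← lintegral_mellin h0 h1 (mul_pos hc hx), ← lintegral_mul_const _ (by fun_prop)]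
        refine setLIntegral_congr_fun measurableSet_Ioi fun t ht => ?_
        have ht0 : (0 : ℝ) < t := ht
        rw [← mul_assoc, ← ENNReal.ofReal_mul (by positivity)]
    _ = _ := by
        rw [lintegral_const_mul]
        fun_prop

/-! ### Interpolation between weighted `L²` spaces -/

theorem div_one_add_mul_add_sq_le {x p q : ℝ} (hx : 0 < x) :
    x / (1 + x) * (p + q) ^ 2 ≤ p ^ 2 + x * q ^ 2 := by
  rw [div_mul_eq_mul_div, div_le_iff₀ (by positivity)]
  nlinarith [sq_nonneg (p - x * q)]

theorem ofReal_mul_enorm_add_sq_le {x : ℝ} (hx : 0 < x) (y z : ℂ) :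
    ENNReal.ofReal (x / (1 + x)) * ‖y + z‖ₑ ^ 2 ≤ ‖y‖ₑ ^ 2 + ENNReal.ofReal x * ‖z‖ₑ ^ 2 := by
  simp only [← ofReal_norm]
  rw [← ENNReal.ofReal_pow (norm_nonneg _), ← ENNReal.ofReal_pow (norm_nonneg _),
    ← ENNReal.ofReal_pow (norm_nonneg _), ← ENNReal.ofReal_mul (by positivity),
    ← ENNReal.ofReal_mul hx.le, ← ENNReal.ofReal_add (by positivity) (by positivity)]
  refine ENNReal.ofReal_le_ofReal (le_trans ?_ (div_one_add_mul_add_sq_le hx))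
  gcongr
  exact norm_add_le _ _

/-- With `S h = S F + S (h - F)`, the left-hand side is at most the quadratic `K`-functional
`‖S F‖² + t ∫ r |S (h - F)|²`; here `F` is chosen pointwise so that the resulting bound
`a |F|² + t b r |h - F|²` is the least possible. -/
theorem lintegral_kFunctional_le {r : X → ℝ} (hr : Measurable r) (hr1 : ∀ x, 1 ≤ r x)
    (S : Lp ℂ 2 μ →L[ℂ] Lp ℂ 2 μ) {a b : ℝ} (ha : 0 < a) (hb : 0 < b)
    (hS0 : ∀ F, ∫⁻ x, ‖S F x‖ₑ ^ 2 ∂μ ≤ ENNReal.ofReal a * ∫⁻ x, ‖F x‖ₑ ^ 2 ∂μ)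
    (hS1 : ∀ F G : Lp ℂ 2 μ, (F =ᵐ[μ] fun x => (r x ^ (-(1 / 2 : ℝ)) : ℝ) * G x) →
      ∫⁻ x, ENNReal.ofReal (r x) * ‖S F x‖ₑ ^ 2 ∂μ ≤ ENNReal.ofReal b * ∫⁻ x, ‖G x‖ₑ ^ 2 ∂μ)
    (h : Lp ℂ 2 μ) {t : ℝ} (ht : 0 < t) :
    ∫⁻ x, ENNReal.ofReal (1 * r x * t / (1 + 1 * r x * t)) * ‖S h x‖ₑ ^ 2 ∂μ
      ≤ ENNReal.ofReal a *
        ∫⁻ x, ENNReal.ofReal (b / a * r x * t / (1 + b / a * r x * t)) * ‖h x‖ₑ ^ 2 ∂μ := by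
  have hr0 : ∀ x, 0 < r x := fun x => one_pos.trans_le (hr1 x)
  set y : X → ℝ := fun x => b / a * r x * t with hy
  have hym : Measurable y := by fun_prop
  have hy0 : ∀ x, 0 < y x := fun x => by have := hr0 x; positivity
  -- the minimizing decomposition `h = F + r^{-1/2} G`
  have hm0 : MemLp (fun x => ((y x / (1 + y x) : ℝ) : ℂ)) ∞ μ := by
    refine memLp_top_ofReal (by fun_prop) (C := 1) (.of_forall fun x => ?_)
    have := hy0 x
    rw [abs_of_pos (by positivity), div_le_one (by positivity)]
    linarith
  have hm1 : MemLp (fun x => ((Real.sqrt (r x) / (1 + y x) : ℝ) : ℂ)) ∞ μ := by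
    refine memLp_top_ofReal (by fun_prop) (C := (b / a * t)⁻¹) (.of_forall fun x => ?_)
    have h1 := hy0 x
    have h2 := hr0 x
    have h3 : Real.sqrt (r x) ≤ r x := by
      rw [Real.sqrt_le_left h2.le]
      nlinarith [hr1 x]
    rw [abs_of_pos (by positivity), div_le_iff₀ (by positivity)]
    have h4 : (b / a * t)⁻¹ * y x = r x := by simp only [hy]; field_simp
    have h5 : 0 < (b / a * t)⁻¹ := by positivity
    nlinarith
  set F : Lp ℂ 2 μ := mulL _ hm0 h
  set G : Lp ℂ 2 μ := mulL _ hm1 h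
  have hFx := coeFn_mulL hm0 h
  have hGx := coeFn_mulL hm1 h
  have hd : (h - F : Lp ℂ 2 μ) =ᵐ[μ] fun x => (r x ^ (-(1 / 2 : ℝ)) : ℝ) * G x := by
    filter_upwards [hFx, hGx, Lp.coeFn_sub h F] with x h1 h2 h3
    have e1 := hr0 x
    have e0 : r x ^ (-(1 / 2 : ℝ)) = (Real.sqrt (r x))⁻¹ := by
      rw [Real.rpow_neg e1.le, Real.sqrt_eq_rpow]
    rw [h3, Pi.sub_apply, h1, h2, ← mul_assoc, ← Complex.ofReal_mul, e0]
    have e2 := hy0 x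
    have e : (Real.sqrt (r x))⁻¹ * (Real.sqrt (r x) / (1 + y x)) = 1 - y x / (1 + y x) := by
      have : Real.sqrt (r x) ≠ 0 := by positivity
      field_simp
      ring
    rw [e]
    push_cast
    ring
  have hSm : ∀ v : Lp ℂ 2 μ, Measurable v := fun v => (Lp.stronglyMeasurable v).measurable
  calc _ ≤ ∫⁻ x, (‖S F x‖ₑ ^ 2
          + ENNReal.ofReal t * (ENNReal.ofReal (r x) * ‖S (h - F) x‖ₑ ^ 2)) ∂μ := by
        refine lintegral_mono_ae ?_
        have : S h = S F + S (h - F) := by rw [← map_add]; simp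
        rw [this]
        filter_upwards [Lp.coeFn_add (S F) (S (h - F))] with x h1
        have e1 := hr0 x
        rw [h1, Pi.add_apply, one_mul]
        refine (ofReal_mul_enorm_add_sq_le (by positivity) _ _).trans (le_of_eq ?_)
        rw [← mul_assoc, ← ENNReal.ofReal_mul ht.le, mul_comm t]
    _ = ∫⁻ x, ‖S F x‖ₑ ^ 2 ∂μ
        + ENNReal.ofReal t * ∫⁻ x, (ENNReal.ofReal (r x) * ‖S (h - F) x‖ₑ ^ 2) ∂μ := by
        have := hSm (S F)
        have := hSm (S (h - F))
        rw [lintegral_add_left (by fun_prop), lintegral_const_mul _ (by fun_prop)]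
    _ ≤ ENNReal.ofReal a * ∫⁻ x, ‖F x‖ₑ ^ 2 ∂μ
        + ENNReal.ofReal t * (ENNReal.ofReal b * ∫⁻ x, ‖G x‖ₑ ^ 2 ∂μ) := by
        gcongr
        · exact hS0 F
        · exact hS1 _ _ hd
    _ = ∫⁻ x, (ENNReal.ofReal a * ‖F x‖ₑ ^ 2 + ENNReal.ofReal (t * b) * ‖G x‖ₑ ^ 2) ∂μ := by
        have := hSm F
        have := hSm G
        rw [lintegral_add_left (by fun_prop), lintegral_const_mul _ (by fun_prop),
          lintegral_const_mul _ (by fun_prop), ← mul_assoc, ENNReal.ofReal_mul ht.le]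
    _ = ∫⁻ x, ENNReal.ofReal a * (ENNReal.ofReal (y x / (1 + y x)) * ‖h x‖ₑ ^ 2) ∂μ := by
        refine lintegral_congr_ae ?_
        filter_upwards [hFx, hGx] with x h1 h2
        have e1 := hr0 x
        have e2 := hy0 x
        rw [h1, h2, enorm_mul_ofReal_sq, enorm_mul_ofReal_sq, ← mul_assoc, ← mul_assoc, ← mul_assoc,
          ← ENNReal.ofReal_mul ha.le, ← ENNReal.ofReal_mul (by positivity),
          ← ENNReal.ofReal_mul ha.le, ← add_mul,
          ← ENNReal.ofReal_add (by positivity) (by positivity)]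
        congr 2
        have e3 : t * b * r x = a * y x := by simp only [hy]; field_simp
        rw [div_pow, div_pow, Real.sq_sqrt e1.le, mul_div_assoc', mul_div_assoc', e3]
        field_simp
        ring
    _ = _ := by
        have := hSm h
        rw [lintegral_const_mul _ (by fun_prop)]

/-- Interpolation with weights and with the exact constant: if the square of the norm of `S` is at
most `a` on `L²(dμ)` and at most `b` on `L²(r dμ)`, then it is at most `a^{1-α} b^α` on
`L²(r^α dμ)`, `0 < α < 1`. -/
theorem lintegral_rpow_mul_enorm_sq_le [SFinite μ] {r : X → ℝ} (hr : Measurable r)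
    (hr1 : ∀ x, 1 ≤ r x)
    (S : Lp ℂ 2 μ →L[ℂ] Lp ℂ 2 μ) {a b : ℝ} (ha : 0 < a) (hb : 0 < b)
    (hS0 : ∀ F, ∫⁻ x, ‖S F x‖ₑ ^ 2 ∂μ ≤ ENNReal.ofReal a * ∫⁻ x, ‖F x‖ₑ ^ 2 ∂μ)
    (hS1 : ∀ F G : Lp ℂ 2 μ, (F =ᵐ[μ] fun x => (r x ^ (-(1 / 2 : ℝ)) : ℝ) * G x) →
      ∫⁻ x, ENNReal.ofReal (r x) * ‖S F x‖ₑ ^ 2 ∂μ ≤ ENNReal.ofReal b * ∫⁻ x, ‖G x‖ₑ ^ 2 ∂μ)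
    {α : ℝ} (h0 : 0 < α) (h1 : α < 1) (h : Lp ℂ 2 μ) :
    ∫⁻ x, ENNReal.ofReal (r x ^ α) * ‖S h x‖ₑ ^ 2 ∂μ
      ≤ ENNReal.ofReal (a ^ (1 - α) * b ^ α) *
        ∫⁻ x, ENNReal.ofReal (r x ^ α) * ‖h x‖ₑ ^ 2 ∂μ := by
  have hr0 : ∀ x, 0 < r x := fun x => one_pos.trans_le (hr1 x)
  have hc := mellinConst_pos h0 h1
  have key : ENNReal.ofReal (mellinConst α) * ∫⁻ x, ENNReal.ofReal (r x ^ α) * ‖S h x‖ₑ ^ 2 ∂μ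
      ≤ ENNReal.ofReal (mellinConst α) * (ENNReal.ofReal (a ^ (1 - α) * b ^ α) *
        ∫⁻ x, ENNReal.ofReal (r x ^ α) * ‖h x‖ₑ ^ 2 ∂μ) := by
    have e1 := lintegral_lintegral_mellin hr hr0 h0 h1 one_pos (S h)
    have e2 := lintegral_lintegral_mellin hr hr0 h0 h1 (div_pos hb ha) h
    rw [Real.one_rpow, one_mul] at e1
    have e3 : ENNReal.ofReal (mellinConst α) * ENNReal.ofReal (a ^ (1 - α) * b ^ α)
        = ENNReal.ofReal a * ENNReal.ofReal ((b / a) ^ α * mellinConst α) := by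
      rw [← ENNReal.ofReal_mul hc.le, ← ENNReal.ofReal_mul ha.le, Real.div_rpow hb.le ha.le,
        Real.rpow_sub ha, Real.rpow_one]
      congr 1
      ring
    rw [← mul_assoc, e3, mul_assoc, ← e2, ← e1,
      ← lintegral_const_mul' _ _ ENNReal.ofReal_ne_top]
    refine setLIntegral_mono' measurableSet_Ioi fun t ht => ?_
    rw [mul_left_comm]
    gcongr
    exact lintegral_kFunctional_le hr hr1 S ha hb hS0 hS1 h ht
  refine (ENNReal.mul_le_mul_iff_right ?_ ENNReal.ofReal_ne_top).1 key
  simpa using hc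

end General

/-! ### Bounds for `ξ coth (πξ)` -/

theorem sinh_le_mul_cosh {t : ℝ} (ht : 0 ≤ t) : Real.sinh t ≤ t * Real.cosh t := by
  have hd : ∀ x : ℝ, HasDerivAt (fun x => x * Real.cosh x - Real.sinh x) (x * Real.sinh x) x := by
    intro x
    exact (((hasDerivAt_id x).mul (Real.hasDerivAt_cosh x)).sub
      (Real.hasDerivAt_sinh x)).congr_deriv (by simp)
  have hm : MonotoneOn (fun x => x * Real.cosh x - Real.sinh x) (Ici 0) := by
    refine monotoneOn_of_deriv_nonneg (convex_Ici 0)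
      (fun x _ => (hd x).continuousAt.continuousWithinAt)
      (fun x _ => (hd x).differentiableAt.differentiableWithinAt) fun x hx => ?_
    rw [interior_Ici] at hx
    rw [(hd x).deriv]
    exact mul_nonneg (le_of_lt hx) (Real.sinh_nonneg_iff.2 (le_of_lt hx))
  have := hm (by simp : (0 : ℝ) ∈ Ici 0) ht ht
  simp only [zero_mul, Real.sinh_zero, sub_zero] at this
  linarith

theorem cosh_sub_one_le {t : ℝ} (ht : 0 ≤ t) : Real.cosh t - 1 ≤ t * Real.sinh t / 2 := by
  obtain ⟨s, rfl⟩ : ∃ s, t = 2 * s := ⟨t / 2, by ring⟩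
  have hs : 0 ≤ s := by linarith
  have h := mul_le_mul_of_nonneg_left (sinh_le_mul_cosh hs) (Real.sinh_nonneg_iff.2 hs)
  rw [Real.cosh_two_mul, Real.sinh_two_mul, Real.cosh_sq]
  nlinarith

theorem sinh_mul_le {t : ℝ} (ht : 0 ≤ t) : Real.sinh t * (1 - t ^ 2 / 4) ≤ t := by
  have hd : ∀ x : ℝ, HasDerivAt (fun x => x - Real.sinh x * (1 - x ^ 2 / 4))
      (1 - (Real.cosh x * (1 - x ^ 2 / 4) - Real.sinh x * x / 2)) x := by
    intro x
    have h2 : HasDerivAt (fun x : ℝ => 1 - x ^ 2 / 4) (-(x / 2)) x := by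
      exact (((hasDerivAt_pow 2 x).div_const 4).const_sub 1).congr_deriv (by norm_num; ring)
    exact ((hasDerivAt_id x).sub ((Real.hasDerivAt_sinh x).mul h2)).congr_deriv (by ring)
  have hm : MonotoneOn (fun x => x - Real.sinh x * (1 - x ^ 2 / 4)) (Ici 0) := by
    refine monotoneOn_of_deriv_nonneg (convex_Ici 0)
      (fun x _ => (hd x).continuousAt.continuousWithinAt)
      (fun x _ => (hd x).differentiableAt.differentiableWithinAt) fun x hx => ?_
    rw [interior_Ici] at hx
    rw [(hd x).deriv]
    nlinarith [cosh_sub_one_le (le_of_lt hx), mul_nonneg (Real.cosh_pos x).le (sq_nonneg x)]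
  have := hm (by simp : (0 : ℝ) ∈ Ici 0) ht ht
  simp only [Real.sinh_zero, zero_mul, sub_zero] at this
  linarith

theorem sinh_sq_mul_le {t : ℝ} (ht : 0 ≤ t) :
    Real.sinh t ^ 2 * (1 + t ^ 2 / 2) ≤ (t * Real.cosh t) ^ 2 := by
  have hs := Real.sinh_nonneg_iff.2 ht
  have key : Real.sinh t ^ 2 * (1 - t ^ 2 / 2) ≤ t ^ 2 := by
    rcases le_total (t ^ 2) 4 with h | h
    · have h1 := pow_le_pow_left₀ (mul_nonneg hs (by linarith)) (sinh_mul_le ht) 2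
      nlinarith [mul_nonneg (sq_nonneg (Real.sinh t)) (sq_nonneg (t ^ 2))]
    · nlinarith [sq_nonneg (Real.sinh t)]
  rw [mul_pow, Real.cosh_sq]
  nlinarith

theorem xiCoth_neg (ξ : ℝ) : xiCoth (-ξ) = xiCoth ξ := by
  simp [xiCoth, div_neg]

theorem measurable_xiCoth : Measurable xiCoth := by
  unfold xiCoth
  fun_prop

/-- For `t = πξ` this says `t coth t ≥ (1 + 4t²/π²)^{1/2}`; it follows from `sinh_sq_mul_le` and
`π² ≥ 8`. -/
theorem le_xiCoth {ξ : ℝ} (hξ : ξ ≠ 0) : 1 / Real.pi * Real.sqrt (1 + 4 * ξ ^ 2) ≤ xiCoth ξ := by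
  wlog h : 0 < ξ generalizing ξ
  · have := this (neg_ne_zero.2 hξ) (by
      rcases lt_or_gt_of_ne hξ with h' | h'
      · linarith
      · exact absurd h' h)
    rwa [xiCoth_neg, neg_sq] at this
  have hp := Real.pi_pos
  have ht : 0 < Real.pi * ξ := by positivity
  have hs : 0 < Real.sinh (Real.pi * ξ) := Real.sinh_pos_iff.2 ht
  rw [xiCoth, div_mul_eq_mul_div, one_mul, mul_div_assoc', div_le_div_iff₀ hp hs]
  refine (sq_le_sq₀ (by positivity) (by have := Real.cosh_pos (Real.pi * ξ); positivity)).1 ?_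
  rw [mul_pow, Real.sq_sqrt (by positivity)]
  have h1 := sinh_sq_mul_le ht.le
  have h2 : 4 * ξ ^ 2 ≤ (Real.pi * ξ) ^ 2 / 2 := by
    have : 8 ≤ Real.pi ^ 2 := by nlinarith [Real.pi_gt_three]
    nlinarith [sq_nonneg ξ]
  calc _ ≤ (1 + (Real.pi * ξ) ^ 2 / 2) * Real.sinh (Real.pi * ξ) ^ 2 := by gcongr
    _ ≤ (Real.pi * ξ * Real.cosh (Real.pi * ξ)) ^ 2 := by linarith
    _ = _ := by ring

theorem xiCoth_le {ξ : ℝ} (hξ : ξ ≠ 0) : xiCoth ξ ≤ Real.sqrt (1 + 4 * ξ ^ 2) := by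
  wlog h : 0 < ξ generalizing ξ
  · have := this (neg_ne_zero.2 hξ) (by
      rcases lt_or_gt_of_ne hξ with h' | h'
      · linarith
      · exact absurd h' h)
    rwa [xiCoth_neg, neg_sq] at this
  have hp := Real.pi_pos
  have ht : 0 < Real.pi * ξ := by positivity
  have hs : 0 < Real.sinh (Real.pi * ξ) := Real.sinh_pos_iff.2 ht
  have h1 : Real.cosh (Real.pi * ξ) ≤ Real.sinh (Real.pi * ξ) + 1 := by
    have := Real.cosh_sub_sinh (Real.pi * ξ)
    have h2 : Real.exp (-(Real.pi * ξ)) ≤ 1 := Real.exp_le_one_iff.2 (by linarith)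
    linarith
  have h2 : Real.pi * ξ ≤ Real.sinh (Real.pi * ξ) := Real.self_le_sinh_iff.2 ht.le
  have h3 : xiCoth ξ ≤ ξ + 1 / 2 := by
    rw [xiCoth, mul_div_assoc', div_le_iff₀ hs]
    nlinarith [Real.pi_gt_three, mul_le_mul_of_nonneg_left h1 h.le]
  refine h3.trans (Real.le_sqrt_of_sq_le ?_)
  nlinarith [sq_nonneg (ξ - 1 / 2)]

/-! ### The transform as a unitary operator -/

theorem mapA_surjective : Function.Surjective mapA := by
  intro v
  have hl : ∀ ω, Real.artanh (-(subst ω)) = ω := fun ω => by simp [subst, Real.artanh_tanh]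
  have hg : MemLp (fun x => v (Real.artanh (-x))) 2 muTilde := by
    rw [← measurePreserving_subst.map_eq, measurableEmbedding_subst.memLp_map_measure_iff]
    have : (fun x => v (Real.artanh (-x))) ∘ subst = v := by
      funext ω; simp [hl]
    rw [this]
    exact Lp.memLp v
  refine ⟨hg.toLp, ?_⟩
  refine Lp.ext ?_
  have h1 := Lp.coeFn_compMeasurePreserving hg.toLp measurePreserving_subst
  have h2 := measurePreserving_subst.quasiMeasurePreserving.ae hg.coeFn_toLp
  filter_upwards [h1, h2] with ω h1 h2
  refine h1.trans (h2.trans ?_)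
  rw [hl]

/-- The unitary operator `u ↦ 𝓕 (A u)` from `L̃₂(-1,1)` onto `L₂(ℝ)`; it is `𝒫` up to the dilation
of the variable `ξ = -πη`. -/
def transformU : LTilde ≃ₗᵢ[ℂ] Lp ℂ 2 (volume : Measure ℝ) :=
  (LinearIsometryEquiv.ofSurjective mapA mapA_surjective).trans
    (Lp.fourierTransformₗᵢ ℝ ℂ)

theorem pTransform_eq (u : LTilde) (ξ : ℝ) : pTransform u ξ = transformU u (-(ξ / Real.pi)) := rfl

/-- The weight `(1 + 4ξ²)^{1/2}` at `ξ = -πη`. -/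
def weight (η : ℝ) : ℝ := Real.sqrt (1 + 4 * (Real.pi * η) ^ 2)

theorem measurable_weight : Measurable weight := by unfold weight; fun_prop

theorem one_le_weight (η : ℝ) : 1 ≤ weight η := by
  unfold weight
  rw [Real.one_le_sqrt]
  have := sq_nonneg (Real.pi * η)
  linarith

theorem weight_pos' (η : ℝ) : 0 < weight η := one_pos.trans_le (one_le_weight η)

theorem weight_rpow (s ξ : ℝ) : weight (-(ξ / Real.pi)) ^ (2 * s) = (1 + 4 * ξ ^ 2) ^ s := by
  have := Real.pi_ne_zero
  rw [weight, Real.rpow_mul (Real.sqrt_nonneg _), Real.rpow_two, Real.sq_sqrt (by positivity)]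
  congr 3
  field_simp

/-- The symbol `ξ coth (πξ)` at `ξ = -πη`; it is an even function of `ξ`. -/
def symbol (η : ℝ) : ℝ := xiCoth (Real.pi * η)

theorem measurable_symbol : Measurable symbol :=
  measurable_xiCoth.comp (by fun_prop)

theorem symbol_eq (ξ : ℝ) : symbol (-(ξ / Real.pi)) = xiCoth ξ := by
  have := Real.pi_ne_zero
  rw [symbol, ← xiCoth_neg ξ]
  congr 1
  field_simp

theorem symbol_bounds : ∀ᵐ η : ℝ, 1 / Real.pi * weight η ≤ symbol η ∧
    symbol η ≤ weight η := by
  filter_upwards [compl_mem_ae_iff.2 (measure_singleton (0 : ℝ))] with η hη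
  have : Real.pi * η ≠ 0 := mul_ne_zero Real.pi_ne_zero hη
  exact ⟨le_xiCoth this, xiCoth_le this⟩

theorem integral_comp_dilation {F : Type*} [NormedAddCommGroup F] [NormedSpace ℝ F] (g : ℝ → F) :
    ∫ ξ : ℝ, g (-(ξ / Real.pi)) = Real.pi • ∫ η, g η := by
  have := Measure.integral_comp_div (fun x => g (-x)) Real.pi
  rw [this, abs_of_pos Real.pi_pos, integral_neg_eq_self]

theorem integrable_comp_dilation_iff {F : Type*} [NormedAddCommGroup F] (g : ℝ → F) :
    Integrable (fun ξ : ℝ => g (-(ξ / Real.pi))) ↔ Integrable g := by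
  have := integrable_comp_mul_left_iff g (R := -(1 / Real.pi))
    (neg_ne_zero.2 (one_div_pos.2 Real.pi_pos).ne')
  rw [← this]
  have e : (fun ξ : ℝ => g (-(ξ / Real.pi))) = fun x => g (-(1 / Real.pi) * x) := by
    funext ξ; congr 1; ring
  rw [e]

/-- The square of the `H̃^s` norm as an extended real: for `u = transformU v` it equals
`(1/π) ∫ (1 + 4ξ²)^s |𝒫[v](ξ)|² dξ`, the factor `1/π` being absorbed by the dilation `ξ = -πη`. -/
def energy (s : ℝ) (u : Lp ℂ 2 (volume : Measure ℝ)) : ℝ≥0∞ :=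
  ∫⁻ η, ENNReal.ofReal (weight η ^ (2 * s)) * ‖u η‖ₑ ^ 2

theorem energy_eq (s : ℝ) (u : Lp ℂ 2 (volume : Measure ℝ)) :
    energy s u = ∫⁻ η, ENNReal.ofReal (weight η ^ (2 * s) * ‖u η‖ ^ 2) := by
  refine lintegral_congr fun η => ?_
  rw [ENNReal.ofReal_mul (Real.rpow_nonneg (weight_pos' η).le _),
    ENNReal.ofReal_pow (norm_nonneg _), ofReal_norm]

theorem measurable_energy_density (s : ℝ) (u : Lp ℂ 2 (volume : Measure ℝ)) :
    Measurable fun η => weight η ^ (2 * s) * ‖u η‖ ^ 2 := by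
  have := (Lp.stronglyMeasurable u).measurable
  have := measurable_weight
  fun_prop

theorem energy_density_nonneg (s : ℝ) (u : Lp ℂ 2 (volume : Measure ℝ)) (η : ℝ) :
    0 ≤ weight η ^ (2 * s) * ‖u η‖ ^ 2 := by
  have := weight_pos' η
  positivity

theorem mem_HTilde_iff {s : ℝ} {u : LTilde} : u ∈ HTilde s ↔ energy s (transformU u) ≠ ∞ := by
  have e : (fun ξ : ℝ => (1 + 4 * ξ ^ 2) ^ s * ‖pTransform u ξ‖ ^ 2)
      = fun ξ : ℝ => (fun η => weight η ^ (2 * s) * ‖transformU u η‖ ^ 2) (-(ξ / Real.pi)) := by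
    funext ξ
    simp only [weight_rpow, pTransform_eq]
  have : u ∈ HTilde s ↔ Integrable (fun ξ : ℝ => (1 + 4 * ξ ^ 2) ^ s * ‖pTransform u ξ‖ ^ 2) :=
    Iff.rfl
  rw [this, e, integrable_comp_dilation_iff
      (fun η => weight η ^ (2 * s) * ‖transformU u η‖ ^ 2),
    energy_eq, ← lt_top_iff_ne_top, ← hasFiniteIntegral_iff_ofReal
    (.of_forall (energy_density_nonneg s _)), Integrable,
    and_iff_right (measurable_energy_density s _).aestronglyMeasurable]

theorem normHTilde_eq (s : ℝ) (u : LTilde) :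
    normHTilde s u = Real.sqrt (energy s (transformU u)).toReal := by
  have e : (fun ξ : ℝ => (1 + 4 * ξ ^ 2) ^ s * ‖pTransform u ξ‖ ^ 2)
      = fun ξ : ℝ => (fun η => weight η ^ (2 * s) * ‖transformU u η‖ ^ 2) (-(ξ / Real.pi)) := by
    funext ξ
    simp only [weight_rpow, pTransform_eq]
  rw [normHTilde, e, integral_comp_dilation
      (fun η => weight η ^ (2 * s) * ‖transformU u η‖ ^ 2),
    energy_eq, integral_eq_lintegral_of_nonneg_ae
    (.of_forall (energy_density_nonneg s _)) (measurable_energy_density s _).aestronglyMeasurable,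
    smul_eq_mul, ← mul_assoc, one_div_mul_cancel Real.pi_ne_zero, one_mul]

/-! ### The potential as a multiplication operator -/

theorem ae_muTilde_of_ae {P : ℝ → Prop} (h : ∀ᵐ x ∂(volume.restrict (Ioo (-1 : ℝ) 1)), P x) :
    ∀ᵐ x ∂muTilde, P x :=
  (withDensity_absolutelyContinuous _ _).ae_le h

theorem ae_muTilde_mem : ∀ᵐ x ∂muTilde, x ∈ Ioo (-1 : ℝ) 1 :=
  ae_muTilde_of_ae (ae_restrict_mem measurableSet_Ioo)

theorem integral_muTilde (g : ℝ → ℂ) :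
    ∫ x, ((1 - x ^ 2 : ℝ) : ℂ) * g x ∂muTilde = ∫ x in Ioo (-1 : ℝ) 1, g x := by
  rw [muTilde, integral_withDensity_eq_integral_toReal_smul (by fun_prop)
    (.of_forall fun _ => ENNReal.ofReal_lt_top)]
  refine setIntegral_congr_fun measurableSet_Ioo fun x hx => ?_
  have : 0 < 1 - x ^ 2 := by nlinarith [hx.1, hx.2]
  rw [ENNReal.toReal_ofReal (by positivity), Complex.real_smul, ← mul_assoc, ← Complex.ofReal_mul,
    one_div_mul_cancel this.ne', Complex.ofReal_one, one_mul]

theorem memLp_potential {V : ℝ → ℝ} {M : ℝ}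
    (hVm : AEMeasurable V (volume.restrict (Ioo (-1 : ℝ) 1)))
    (hV0 : ∀ᵐ x ∂(volume.restrict (Ioo (-1 : ℝ) 1)), 0 ≤ V x)
    (hVM : ∀ᵐ x ∂(volume.restrict (Ioo (-1 : ℝ) 1)), (1 - x ^ 2) * V x ≤ M) :
    MemLp (fun x => (((1 - x ^ 2) * V x : ℝ) : ℂ)) ∞ muTilde := by
  refine memLp_top_ofReal (C := M) ?_ ?_
  · exact ((by fun_prop : Measurable fun x : ℝ => 1 - x ^ 2).aemeasurable).mul
      (hVm.mono_ac (withDensity_absolutelyContinuous _ _))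
  · filter_upwards [ae_muTilde_of_ae hV0, ae_muTilde_of_ae hVM, ae_muTilde_mem] with x h1 h2 h3
    rwa [abs_of_nonneg (mul_nonneg (by nlinarith [h3.1, h3.2]) h1)]

theorem form_eq {V : ℝ → ℝ}
    (hV : MemLp (fun x => (((1 - x ^ 2) * V x : ℝ) : ℂ)) ∞ muTilde) (u g : LTilde) :
    form V u g = inner ℂ g (mulL _ hV u)
      + ∫ η, (symbol η : ℂ) * transformU u η * conj (transformU g η) := by
  rw [form]
  congr 1
  · rw [← integral_muTilde, L2.inner_def]
    refine integral_congr_ae ?_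
    filter_upwards [coeFn_mulL hV u] with x hx
    rw [hx, RCLike.inner_apply]
    push_cast
    ring
  · have : (fun ξ : ℝ => (xiCoth ξ : ℂ) * pTransform u ξ * conj (pTransform g ξ))
        = fun ξ : ℝ => (fun η => (symbol η : ℂ) * transformU u η * conj (transformU g η))
          (-(ξ / Real.pi)) := by
      funext ξ
      simp only [symbol_eq, pTransform_eq]
    rw [this, integral_comp_dilation
        (fun η => (symbol η : ℂ) * transformU u η * conj (transformU g η)), Complex.real_smul,
      ← mul_assoc, ← Complex.ofReal_mul,
      one_div_mul_cancel Real.pi_ne_zero, Complex.ofReal_one, one_mul]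

/-! ### Real multiplication operators -/

section Operator

variable {X : Type*} [MeasurableSpace X] {μ : Measure X}

theorem inner_mulL_right {m : X → ℝ} (hm : MemLp (fun x => (m x : ℂ)) ∞ μ) (u v : Lp ℂ 2 μ) :
    inner ℂ u (mulL m hm v) = ∫ x, (m x : ℂ) * v x * conj (u x) ∂μ := by
  rw [L2.inner_def]
  refine integral_congr_ae ?_
  filter_upwards [coeFn_mulL hm v] with x hx
  rw [hx, RCLike.inner_apply]

theorem inner_mulL_left {m : X → ℝ} (hm : MemLp (fun x => (m x : ℂ)) ∞ μ) (u v : Lp ℂ 2 μ) :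
    inner ℂ (mulL m hm u) v = inner ℂ u (mulL m hm v) := by
  rw [inner_mulL_right, L2.inner_def]
  refine integral_congr_ae ?_
  filter_upwards [coeFn_mulL hm u] with x hx
  rw [hx, RCLike.inner_apply, map_mul, Complex.conj_ofReal]
  ring

theorem norm_sq_eq_integral (u : Lp ℂ 2 μ) : ‖u‖ ^ 2 = ∫ x, ‖u x‖ ^ 2 ∂μ := by
  have h : inner ℂ u u = ((∫ x, ‖u x‖ ^ 2 ∂μ : ℝ) : ℂ) := by
    rw [L2.inner_def, ← integral_complex_ofReal]
    refine integral_congr_ae (.of_forall fun x => ?_)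
    simp
  rw [← inner_self_eq_norm_sq (𝕜 := ℂ), h]
  exact Complex.ofReal_re _

theorem norm_mulL_sq {m : X → ℝ} (hm : MemLp (fun x => (m x : ℂ)) ∞ μ) (u : Lp ℂ 2 μ) :
    ‖mulL m hm u‖ ^ 2 = ∫ x, m x ^ 2 * ‖u x‖ ^ 2 ∂μ := by
  rw [norm_sq_eq_integral]
  refine integral_congr_ae ?_
  filter_upwards [coeFn_mulL hm u] with x hx
  rw [hx, norm_mul, mul_pow, Complex.norm_real, Real.norm_eq_abs, sq_abs]

theorem inner_mulL_self {m : X → ℝ} (hm : MemLp (fun x => (m x : ℂ)) ∞ μ) (u : Lp ℂ 2 μ) :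
    inner ℂ (mulL m hm u) u = ((∫ x, m x * ‖u x‖ ^ 2 ∂μ : ℝ) : ℂ) := by
  rw [inner_mulL_left, inner_mulL_right, ← integral_complex_ofReal]
  refine integral_congr_ae (.of_forall fun x => ?_)
  simp only
  rw [mul_assoc, RCLike.mul_conj]
  push_cast
  rfl

theorem integrable_mul_norm_sq {m : X → ℝ} (hm : MemLp (fun x => (m x : ℂ)) ∞ μ) (u : Lp ℂ 2 μ) :
    Integrable (fun x => m x * ‖u x‖ ^ 2) μ := by
  have h := (L2.integrable_inner (𝕜 := ℂ) u (mulL m hm u)).re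
  refine h.congr ?_
  filter_upwards [coeFn_mulL hm u] with x hx
  rw [hx, RCLike.inner_apply, mul_assoc, RCLike.mul_conj]
  refine (Complex.re_ofReal_mul _ _).trans ?_
  rw [← RCLike.ofReal_pow]
  rfl

theorem integrable_norm_sq (u : Lp ℂ 2 μ) : Integrable (fun x => ‖u x‖ ^ 2) μ :=
  (memLp_two_iff_integrable_sq_norm (Lp.aestronglyMeasurable u)).1 (Lp.memLp u)

theorem mul_norm_sq_le_re_inner_mulL {m : X → ℝ} (hm : MemLp (fun x => (m x : ℂ)) ∞ μ) {c : ℝ}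
    (hc : ∀ᵐ x ∂μ, c ≤ m x) (u : Lp ℂ 2 μ) : c * ‖u‖ ^ 2 ≤ (inner ℂ (mulL m hm u) u).re := by
  rw [inner_mulL_self, Complex.ofReal_re, norm_sq_eq_integral, ← integral_const_mul]
  refine integral_mono_ae ((integrable_norm_sq u).const_mul c) (integrable_mul_norm_sq hm u) ?_
  filter_upwards [hc] with x hx
  gcongr

/-- For `0 ≤ m ≤ M` one has `m² ≤ M m`. -/
theorem norm_mulL_sq_le {m : X → ℝ} (hm : MemLp (fun x => (m x : ℂ)) ∞ μ) {M : ℝ}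
    (h0 : ∀ᵐ x ∂μ, 0 ≤ m x) (hM : ∀ᵐ x ∂μ, m x ≤ M) (u : Lp ℂ 2 μ) :
    ‖mulL m hm u‖ ^ 2 ≤ M * (inner ℂ (mulL m hm u) u).re := by
  rw [inner_mulL_self, Complex.ofReal_re, norm_mulL_sq, ← integral_const_mul]
  refine integral_mono_of_nonneg (.of_forall fun x => by positivity)
    ((integrable_mul_norm_sq hm u).const_mul M) ?_
  filter_upwards [h0, hM] with x h0 hM
  rw [← mul_assoc, sq]
  gcongr

/-! ### Coercive operators and the regularity estimate -/

/-- The Lax–Milgram theorem for an operator, with the bound `κ⁻¹` for its inverse `S`. -/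
theorem exists_inverse_of_coercive {H : Type*} [NormedAddCommGroup H] [InnerProductSpace ℂ H]
    [CompleteSpace H] (T : H →L[ℂ] H) {κ : ℝ} (hκ : 0 < κ)
    (hT : ∀ u, κ * ‖u‖ ^ 2 ≤ (inner ℂ (T u) u).re) :
    ∃ S : H →L[ℂ] H, (∀ u, T (S u) = u) ∧ (∀ u, S (T u) = u) ∧ ∀ u, ‖S u‖ ≤ κ⁻¹ * ‖u‖ := by
  have hu : IsUnit T := T.isUnit_of_forall_le_norm_inner_map (c := ⟨κ, hκ.le⟩) hκ fun x => by
    rw [mul_comm]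
    exact (hT x).trans (Complex.re_le_norm _)
  obtain ⟨⟨T', S, h1, h2⟩, rfl⟩ := hu
  have h3 : ∀ u, T' (S u) = u := fun u => DFunLike.congr_fun h1 u
  refine ⟨S, h3, fun u => DFunLike.congr_fun h2 u, fun u => ?_⟩
  have h4 := hT (S u)
  simp only [h3] at h4
  have h5 : (inner ℂ u (S u)).re ≤ ‖u‖ * ‖S u‖ :=
    (Complex.re_le_norm _).trans (norm_inner_le_norm _ _)
  rcases (norm_nonneg (S u)).eq_or_lt with h | h
  · rw [← h]; positivity
  · rw [inv_mul_eq_div, le_div_iff₀ hκ]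
    nlinarith

theorem memLp_rpow_neg {r : X → ℝ} (hr : Measurable r) (hr1 : ∀ x, 1 ≤ r x) {s : ℝ} (hs : 0 ≤ s) :
    MemLp (fun x => ((r x ^ (-s) : ℝ) : ℂ)) ∞ μ := by
  refine memLp_top_ofReal (by fun_prop) (C := 1) (.of_forall fun x => ?_)
  have := one_pos.trans_le (hr1 x)
  rw [abs_of_pos (by positivity)]
  exact Real.rpow_le_one_of_one_le_of_nonpos (hr1 x) (by linarith)

theorem norm_mulL_le {m : X → ℝ} (hm : MemLp (fun x => (m x : ℂ)) ∞ μ)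
    (h1 : ∀ x, |m x| ≤ 1) (u : Lp ℂ 2 μ) : ‖mulL m hm u‖ ≤ ‖u‖ := by
  refine Lp.norm_le_norm_of_ae_le ?_
  filter_upwards [coeFn_mulL hm u] with x hx
  rw [hx, norm_mul, Complex.norm_real]
  exact mul_le_of_le_one_left (norm_nonneg _) (h1 x)

/-- The equation `D N D u + Q u = F` with `D = r^{-1/2}` and `Q = q / r`, where `q ≥ κ r` and `N`
is a bounded operator with `‖N u‖² ≤ M Re ⟨N u, u⟩`, is solved by a bounded operator `S`. Moreover
`S` maps `r^{-α/2} G` into `L²(r^α dμ)` for `0 ≤ α ≤ 1`, with an explicit constant. For `α = 0`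
this is coercivity. For `α = 1` the solution satisfies `q (D u) = G - N (D u)`, and the right-hand
side is bounded by the energy identity. The remaining `α` follow by interpolation. -/
theorem exists_solution_operator [SFinite μ] {r q : X → ℝ} (hr : Measurable r)
    (hr1 : ∀ x, 1 ≤ r x) {κ : ℝ} (hκ : 0 < κ)
    (hq0 : ∀ᵐ x ∂μ, κ * r x ≤ q x) (hQ : MemLp (fun x => ((q x / r x : ℝ) : ℂ)) ∞ μ)
    (N : Lp ℂ 2 μ →L[ℂ] Lp ℂ 2 μ) {M : ℝ} (hM : 0 ≤ M)
    (hN0 : ∀ u, 0 ≤ (inner ℂ (N u) u).re) (hN1 : ∀ u, ‖N u‖ ^ 2 ≤ M * (inner ℂ (N u) u).re)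
    (hD : MemLp (fun x => ((r x ^ (-(1 / 2 : ℝ)) : ℝ) : ℂ)) ∞ μ) :
    ∃ S : Lp ℂ 2 μ →L[ℂ] Lp ℂ 2 μ,
      (∀ u F, mulL _ hD (N (mulL _ hD u)) + mulL _ hQ u = F ↔ u = S F) ∧
      ∀ α : ℝ, 0 ≤ α → α ≤ 1 → ∀ h G : Lp ℂ 2 μ,
        (h =ᵐ[μ] fun x => ((r x ^ (-(α / 2)) : ℝ) : ℂ) * G x) →
        ∫⁻ x, ENNReal.ofReal (r x ^ α) * ‖S h x‖ₑ ^ 2 ∂μ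
          ≤ ENNReal.ofReal ((κ⁻¹ ^ 2) ^ (1 - α) * (κ⁻¹ ^ 2 * (2 + M / (2 * κ))) ^ α * ‖G‖ ^ 2) := by
  have hr0 : ∀ x, 0 < r x := fun x => one_pos.trans_le (hr1 x)
  set D : Lp ℂ 2 μ →L[ℂ] Lp ℂ 2 μ := mulL _ hD
  set Q : Lp ℂ 2 μ →L[ℂ] Lp ℂ 2 μ := mulL _ hQ
  have hQc : ∀ u, κ * ‖u‖ ^ 2 ≤ (inner ℂ (Q u) u).re := fun u => by
    refine mul_norm_sq_le_re_inner_mulL hQ ?_ u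
    filter_upwards [hq0] with x hx
    rwa [le_div_iff₀ (hr0 x)]
  have hT : ∀ u, (inner ℂ ((D ∘L N ∘L D + Q) u) u).re
      = (inner ℂ (N (D u)) (D u)).re + (inner ℂ (Q u) u).re := fun u => by
    have : inner ℂ (D (N (D u))) u = inner ℂ (N (D u)) (D u) := inner_mulL_left hD _ _
    simp [inner_add_left, this]
  obtain ⟨S, hS1, hS2, hS3⟩ := exists_inverse_of_coercive (D ∘L N ∘L D + Q) hκ fun u => by
    rw [hT]
    linarith [hN0 (D u), hQc u]
  have hDn : ∀ u, ‖D u‖ ≤ ‖u‖ := norm_mulL_le hD fun x => by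
    have := hr0 x
    rw [abs_of_pos (by positivity)]
    exact Real.rpow_le_one_of_one_le_of_nonpos (hr1 x) (by norm_num)
  set a : ℝ := κ⁻¹ ^ 2 with ha
  set b : ℝ := κ⁻¹ ^ 2 * (2 + M / (2 * κ)) with hb
  have ha0 : 0 < a := by positivity
  have hb0 : 0 < b := by positivity
  have est0 : ∀ F, ∫⁻ x, ‖S F x‖ₑ ^ 2 ∂μ ≤ ENNReal.ofReal a * ∫⁻ x, ‖F x‖ₑ ^ 2 ∂μ := by
    intro F
    rw [← ofReal_norm_sq_eq_lintegral, ← ofReal_norm_sq_eq_lintegral, ← ENNReal.ofReal_mul ha0.le,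
      ha, ← mul_pow]
    gcongr
    exact hS3 F
  have est1 : ∀ F G : Lp ℂ 2 μ, (F =ᵐ[μ] fun x => (r x ^ (-(1 / 2 : ℝ)) : ℝ) * G x) →
      ∫⁻ x, ENNReal.ofReal (r x) * ‖S F x‖ₑ ^ 2 ∂μ
        ≤ ENNReal.ofReal b * ∫⁻ x, ‖G x‖ₑ ^ 2 ∂μ := by
    intro F G hFG
    have hF : F = D G := Lp.ext (hFG.trans (coeFn_mulL hD G).symm)
    set φ := S F
    set u := D φ
    have hTφ : D (N u) + Q φ = D G := by rw [← hF]; exact hS1 F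
    -- the energy identity bounds the lower order term `N u`
    have hNu : ‖N u‖ ^ 2 ≤ M / (4 * κ) * ‖G‖ ^ 2 := by
      have e1 := hT φ
      have e2 : (D ∘L N ∘L D + Q) φ = D G := hTφ
      have e3 : inner ℂ (D G) φ = inner ℂ G u := inner_mulL_left hD _ _
      rw [e2, e3] at e1
      have e4 : (inner ℂ G u).re ≤ ‖G‖ * ‖u‖ :=
        (Complex.re_le_norm _).trans (norm_inner_le_norm _ _)
      have e5 := hQc φ
      have e6 : κ * ‖u‖ ^ 2 ≤ κ * ‖φ‖ ^ 2 := by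
        gcongr
        exact hDn φ
      have e7 : (inner ℂ (N u) u).re ≤ ‖G‖ ^ 2 / (4 * κ) := by
        rw [le_div_iff₀ (by positivity)]
        have e8 : (inner ℂ (N u) u).re ≤ ‖G‖ * ‖u‖ - κ * ‖u‖ ^ 2 := by linarith
        nlinarith [sq_nonneg (‖G‖ - 2 * κ * ‖u‖)]
      calc _ ≤ M * (inner ℂ (N u) u).re := hN1 u
        _ ≤ M * (‖G‖ ^ 2 / (4 * κ)) := by gcongr
        _ = _ := by ring
    have hGN : ‖G - N u‖ ^ 2 ≤ (2 + M / (2 * κ)) * ‖G‖ ^ 2 := by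
      have e1 := norm_sub_le G (N u)
      have e2 : ‖G - N u‖ ^ 2 ≤ (‖G‖ + ‖N u‖) ^ 2 := by gcongr
      have e3 : M / (2 * κ) = 2 * (M / (4 * κ)) := by field_simp; norm_num
      rw [e3]
      nlinarith [sq_nonneg (‖G‖ - ‖N u‖)]
    -- dividing `D N D φ + Q φ = D G` by `r^{-1/2}` gives `q r^{-1/2} φ = G - N u`
    have hpt : ∀ᵐ x ∂μ, ENNReal.ofReal (r x) * ‖φ x‖ₑ ^ 2
        ≤ ENNReal.ofReal a * ‖(G - N u : Lp ℂ 2 μ) x‖ₑ ^ 2 := by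
      have c1 : D (N u) =ᵐ[μ] _ := coeFn_mulL hD (N u)
      have c2 : D G =ᵐ[μ] _ := coeFn_mulL hD G
      have c3 : Q φ =ᵐ[μ] _ := coeFn_mulL hQ φ
      have c4 := Lp.coeFn_add (D (N u)) (Q φ)
      rw [hTφ] at c4
      filter_upwards [hq0, c1, c2, c3, c4, Lp.coeFn_sub G (N u)] with x h0 h1 h2 h3 h4 h5
      have hx := hr0 x
      rw [Pi.add_apply, h1, h2, h3] at h4
      have h6 : (G - N u : Lp ℂ 2 μ) x = ((q x * r x ^ (-(1 / 2 : ℝ)) : ℝ) : ℂ) * φ x := by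
        have e1 : r x ^ (-(1 / 2 : ℝ)) * r x ^ (-(1 / 2 : ℝ)) = (r x)⁻¹ := by
          rw [← Real.rpow_add hx, ← Real.rpow_neg_one]
          norm_num
        have e2 : q x * r x ^ (-(1 / 2 : ℝ)) = (r x ^ (-(1 / 2 : ℝ)))⁻¹ * (q x / r x) := by
          have hp : 0 < r x ^ (-(1 / 2 : ℝ)) := by positivity
          rw [eq_inv_mul_iff_mul_eq₀ hp.ne', div_eq_mul_inv (q x), ← e1, mul_left_comm]
        have e3 : ((r x ^ (-(1 / 2 : ℝ)) : ℝ) : ℂ) ≠ 0 :=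
          Complex.ofReal_ne_zero.2 (by positivity)
        rw [h5, Pi.sub_apply, e2, Complex.ofReal_mul, mul_assoc, Complex.ofReal_inv,
          eq_inv_mul_iff_mul_eq₀ e3, mul_sub, h4]
        ring
      rw [h6, enorm_mul_ofReal_sq, ← mul_assoc, ← ENNReal.ofReal_mul ha0.le]
      gcongr
      have e1 : (r x ^ (-(1 / 2 : ℝ))) ^ 2 = (r x)⁻¹ := by
        rw [← Real.rpow_mul_natCast hx.le, ← Real.rpow_neg_one]
        norm_num
      have e2 : (κ * r x) ^ 2 ≤ q x ^ 2 := by gcongr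
      rw [mul_pow, e1, ha]
      calc r x = κ⁻¹ ^ 2 * ((κ * r x) ^ 2 * (r x)⁻¹) := by field_simp
        _ ≤ _ := by gcongr
    calc _ ≤ ∫⁻ x, ENNReal.ofReal a * ‖(G - N u : Lp ℂ 2 μ) x‖ₑ ^ 2 ∂μ := lintegral_mono_ae hpt
      _ = ENNReal.ofReal (a * ‖G - N u‖ ^ 2) := by
        rw [lintegral_const_mul' _ _ ENNReal.ofReal_ne_top, ← ofReal_norm_sq_eq_lintegral,
          ENNReal.ofReal_mul ha0.le]
      _ ≤ ENNReal.ofReal (b * ‖G‖ ^ 2) := by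
        rw [hb, mul_assoc]
        gcongr
      _ = _ := by rw [ENNReal.ofReal_mul hb0.le, ofReal_norm_sq_eq_lintegral]
  refine ⟨S, fun u F => ⟨fun h => ?_, fun h => ?_⟩, fun α hα0 hα1 h G hG => ?_⟩
  · rw [← h]; exact (hS2 u).symm
  · rw [h]; exact hS1 F
  · have hh : ∫⁻ x, ENNReal.ofReal (r x ^ α) * ‖h x‖ₑ ^ 2 ∂μ = ENNReal.ofReal (‖G‖ ^ 2) := by
      rw [ofReal_norm_sq_eq_lintegral]
      refine lintegral_congr_ae ?_
      filter_upwards [hG] with x hx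
      have h0 := hr0 x
      rw [hx, enorm_mul_ofReal_sq, ← mul_assoc, ← ENNReal.ofReal_mul (by positivity),
        ← Real.rpow_mul_natCast h0.le, ← Real.rpow_add h0]
      have : α + -(α / 2) * ((2 : ℕ) : ℝ) = 0 := by push_cast; ring
      rw [this]
      simp
    rw [ENNReal.ofReal_mul (by positivity), ← hh]
    rcases hα0.eq_or_lt with h0 | h0
    · rw [← h0]
      simpa using est0 h
    rcases hα1.eq_or_lt with h1 | h1
    · rw [h1] at hG hh ⊢
      have := est1 h G hG
      rw [← ofReal_norm_sq_eq_lintegral] at this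
      rw [hh]
      simpa using this
    · exact lintegral_rpow_mul_enorm_sq_le hr hr1 S ha0 hb0 est0 est1 h0 h1 h

end Operator

/-! ### Coordinates on `H̃^s` -/

/-- Multiplication by `(1 + 4ξ²)^{-s/2}`, in the variable `ξ = -πη`. -/
def besselL (s : ℝ) (hs : 0 ≤ s) :
    Lp ℂ 2 (volume : Measure ℝ) →L[ℂ] Lp ℂ 2 (volume : Measure ℝ) :=
  mulL (fun η => weight η ^ (-s)) (memLp_rpow_neg measurable_weight one_le_weight hs)

theorem coeFn_besselL {s : ℝ} (hs : 0 ≤ s) (ψ : Lp ℂ 2 (volume : Measure ℝ)) :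
    besselL s hs ψ =ᵐ[volume] fun η => ((weight η ^ (-s) : ℝ) : ℂ) * ψ η :=
  coeFn_mulL _ ψ

theorem besselL_besselL {s t : ℝ} (hs : 0 ≤ s) (ht : 0 ≤ t) (ψ : Lp ℂ 2 (volume : Measure ℝ)) :
    besselL s hs (besselL t ht ψ) = besselL (s + t) (add_nonneg hs ht) ψ := by
  refine Lp.ext ?_
  filter_upwards [coeFn_besselL hs (besselL t ht ψ), coeFn_besselL ht ψ,
    coeFn_besselL (add_nonneg hs ht) ψ] with η h1 h2 h3
  rw [h1, h2, h3, ← mul_assoc, ← Complex.ofReal_mul, ← Real.rpow_add (weight_pos' η), neg_add]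

theorem energy_besselL {s : ℝ} (hs : 0 ≤ s) (t : ℝ) (ψ : Lp ℂ 2 (volume : Measure ℝ)) :
    energy t (besselL s hs ψ)
      = ∫⁻ η, ENNReal.ofReal (weight η ^ (2 * (t - s))) * ‖ψ η‖ₑ ^ 2 := by
  refine lintegral_congr_ae ?_
  filter_upwards [coeFn_besselL hs ψ] with η h1
  have h0 := weight_pos' η
  rw [h1, enorm_mul_ofReal_sq, ← mul_assoc, ← ENNReal.ofReal_mul (by positivity),
    ← Real.rpow_mul_natCast h0.le, ← Real.rpow_add h0]
  congr 3
  push_cast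
  ring

theorem energy_besselL_self {s : ℝ} (hs : 0 ≤ s) (ψ : Lp ℂ 2 (volume : Measure ℝ)) :
    energy s (besselL s hs ψ) = ENNReal.ofReal (‖ψ‖ ^ 2) := by
  rw [energy_besselL, ofReal_norm_sq_eq_lintegral]
  simp

theorem symm_besselL_mem {s : ℝ} (hs : 0 ≤ s) (ψ : Lp ℂ 2 (volume : Measure ℝ)) :
    transformU.symm (besselL s hs ψ) ∈ HTilde s := by
  rw [mem_HTilde_iff, LinearIsometryEquiv.apply_symm_apply, energy_besselL_self]
  exact ENNReal.ofReal_ne_top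

/-- Together with `exists_eq_symm_besselL`, this identifies `H̃^s(-1,1)` isometrically with
`L₂(ℝ)`. -/
theorem normHTilde_symm_besselL {s : ℝ} (hs : 0 ≤ s) (ψ : Lp ℂ 2 (volume : Measure ℝ)) :
    normHTilde s (transformU.symm (besselL s hs ψ)) = ‖ψ‖ := by
  rw [normHTilde_eq, LinearIsometryEquiv.apply_symm_apply, energy_besselL_self,
    ENNReal.toReal_ofReal (by positivity), Real.sqrt_sq (norm_nonneg _)]

theorem exists_eq_symm_besselL {s : ℝ} (hs : 0 ≤ s) {u : LTilde} (hu : u ∈ HTilde s) :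
    ∃ ψ, u = transformU.symm (besselL s hs ψ) := by
  set v := transformU u with hv
  have hm : Measurable fun η => ((weight η ^ s : ℝ) : ℂ) * v η := by
    have := (Lp.stronglyMeasurable v).measurable
    have := measurable_weight
    fun_prop
  have hψ : MemLp (fun η => ((weight η ^ s : ℝ) : ℂ) * v η) 2 volume := by
    refine ⟨hm.aestronglyMeasurable, ?_⟩
    rw [eLpNorm_lt_top_iff_lintegral_rpow_enorm_lt_top (by norm_num) (by norm_num)]
    have : energy s v < ∞ := lt_top_iff_ne_top.2 (mem_HTilde_iff.1 hu)
    convert! this using 1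
    refine lintegral_congr fun η => ?_
    rw [ENNReal.toReal_ofNat, ENNReal.rpow_two, enorm_mul_ofReal_sq,
      ← Real.rpow_mul_natCast (weight_pos' η).le]
    congr 3
    push_cast
    ring
  refine ⟨hψ.toLp, ?_⟩
  rw [LinearIsometryEquiv.eq_symm_apply]
  refine Lp.ext ?_
  filter_upwards [coeFn_besselL hs hψ.toLp, hψ.coeFn_toLp] with η h1 h2
  rw [h1, h2, ← mul_assoc, ← Complex.ofReal_mul, ← Real.rpow_add (weight_pos' η)]
  simp [hv]

/-! ### The dual space -/

/-- The supremum in `dualNorm` is over a set that `MemDual` makes bounded, so it is not a junk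
value. -/
theorem norm_apply_le_dualNorm {s : ℝ} {f : HTilde s →ₗ⋆[ℂ] ℂ} (hf : MemDual f) (u : HTilde s) :
    ‖f u‖ ≤ dualNorm f * normHTilde s u := by
  obtain ⟨C, hC⟩ := hf
  have hn : ∀ v : HTilde s, 0 ≤ normHTilde s v := fun v => Real.sqrt_nonneg _
  rcases (hn u).eq_or_lt with h | h
  · have := hC u
    rw [← h, mul_zero] at this ⊢
    exact this
  · have hu : u ≠ 0 := by
      rintro rfl
      have h2 : normHTilde s ((0 : HTilde s) : LTilde) = 0 := by
        rw [normHTilde_eq]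
        have : energy s (0 : Lp ℂ 2 (volume : Measure ℝ)) = 0 := by
          refine (lintegral_congr_ae ?_).trans lintegral_zero
          filter_upwards [Lp.coeFn_zero ℂ 2 (volume : Measure ℝ)] with η hη
          rw [hη]
          simp
        rw [ZeroMemClass.coe_zero, map_zero, this]
        simp
      exact h.ne' h2
    rw [← div_le_iff₀ h]
    refine le_csSup ⟨|C|, ?_⟩ ⟨u, hu, rfl⟩
    rintro _ ⟨v, _, rfl⟩
    exact div_le_of_le_mul₀ (hn v) (abs_nonneg C)
      ((hC v).trans (mul_le_mul_of_nonneg_right (le_abs_self C) (hn v)))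

theorem dualNorm_nonneg {s : ℝ} (f : HTilde s →ₗ⋆[ℂ] ℂ) : 0 ≤ dualNorm f := by
  refine Real.sSup_nonneg ?_
  rintro _ ⟨u, _, rfl⟩
  exact div_nonneg (norm_nonneg _) (Real.sqrt_nonneg _)

/-- Riesz representation of `(H̃^s)^*` by `L²`. -/
theorem exists_riesz {s : ℝ} (hs : 0 ≤ s) {f : HTilde s →ₗ⋆[ℂ] ℂ} (hf : MemDual f) :
    ∃ F : Lp ℂ 2 (volume : Measure ℝ), ‖F‖ ≤ dualNorm f ∧
      ∀ ψ, f ⟨transformU.symm (besselL s hs ψ), symm_besselL_mem hs ψ⟩ = inner ℂ ψ F := by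
  let l : Lp ℂ 2 (volume : Measure ℝ) →ₗ[ℂ] ℂ :=
    { toFun := fun ψ => conj (f ⟨transformU.symm (besselL s hs ψ), symm_besselL_mem hs ψ⟩)
      map_add' := fun ψ φ => by
        rw [← map_add, ← map_add]
        congr 2
        ext1
        simp
      map_smul' := fun c ψ => by
        have : (⟨transformU.symm (besselL s hs (c • ψ)), symm_besselL_mem hs _⟩ : HTilde s)
            = c • ⟨transformU.symm (besselL s hs ψ), symm_besselL_mem hs ψ⟩ := by
          ext1
          simp
        rw [this, LinearMap.map_smulₛₗ, smul_eq_mul, map_mul]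
        simp }
  have hl : ∀ ψ, ‖l ψ‖ ≤ dualNorm f * ‖ψ‖ := fun ψ => by
    have := norm_apply_le_dualNorm hf ⟨transformU.symm (besselL s hs ψ), symm_besselL_mem hs ψ⟩
    rw [normHTilde_symm_besselL] at this
    simpa [l] using this
  let L := l.mkContinuous _ hl
  refine ⟨(InnerProductSpace.toDual ℂ _).symm L, ?_, fun ψ => ?_⟩
  · rw [LinearIsometryEquiv.norm_map]
    exact l.mkContinuous_norm_le (dualNorm_nonneg f) hl
  · rw [← inner_conj_symm, InnerProductSpace.toDual_symm_apply]
    simp [L, l]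

/-! ### The weak problem as an operator equation -/

theorem memLp_symbol_div_weight :
    MemLp (fun η => ((symbol η / weight η : ℝ) : ℂ)) ∞ (volume : Measure ℝ) := by
  refine memLp_top_ofReal (measurable_symbol.div measurable_weight).aemeasurable (C := 1) ?_
  filter_upwards [symbol_bounds] with η h
  have h0 := weight_pos' η
  have h1 : 0 ≤ symbol η := le_trans (by have := Real.pi_pos; positivity) h.1
  rw [abs_of_nonneg (by positivity), div_le_one h0]
  exact h.2

/-- Multiplication by the potential, carried to the Fourier side. -/
def potentialL (V : ℝ → ℝ) (hV : MemLp (fun x => (((1 - x ^ 2) * V x : ℝ) : ℂ)) ∞ muTilde) :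
    Lp ℂ 2 (volume : Measure ℝ) →L[ℂ] Lp ℂ 2 (volume : Measure ℝ) :=
  (transformU.toContinuousLinearEquiv : LTilde →L[ℂ] Lp ℂ 2 (volume : Measure ℝ)) ∘L
    mulL _ hV ∘L
    (transformU.symm.toContinuousLinearEquiv : Lp ℂ 2 (volume : Measure ℝ) →L[ℂ] LTilde)

theorem potentialL_apply {V : ℝ → ℝ}
    (hV : MemLp (fun x => (((1 - x ^ 2) * V x : ℝ) : ℂ)) ∞ muTilde)
    (u : Lp ℂ 2 (volume : Measure ℝ)) :
    potentialL V hV u = transformU (mulL _ hV (transformU.symm u)) := rfl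

/-- In the coordinates `u = (besselL ½ φ)` on `H̃^{1/2}`, the form `[u,g]₁` is that of the operator
`D N D + Q`, where `D = besselL ½`, `N` is the potential and `Q` is multiplication by
`ξ coth(πξ) (1 + 4ξ²)^{-1/2}`. -/
theorem form_symm_besselL {V : ℝ → ℝ}
    (hV : MemLp (fun x => (((1 - x ^ 2) * V x : ℝ) : ℂ)) ∞ muTilde) {s : ℝ} (hs : s = 1 / 2)
    (hs0 : 0 ≤ s) (φ ψ : Lp ℂ 2 (volume : Measure ℝ)) :
    form V (transformU.symm (besselL s hs0 φ)) (transformU.symm (besselL s hs0 ψ))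
      = inner ℂ ψ (besselL s hs0 (potentialL V hV (besselL s hs0 φ))
          + mulL _ memLp_symbol_div_weight φ) := by
  rw [form_eq hV, inner_add_right]
  congr 1
  · have h : inner ℂ (besselL s hs0 ψ) (potentialL V hV (besselL s hs0 φ))
        = inner ℂ ψ (besselL s hs0 (potentialL V hV (besselL s hs0 φ))) := inner_mulL_left _ _ _
    rw [← h, potentialL_apply, ← LinearIsometryEquiv.inner_map_map transformU,
      LinearIsometryEquiv.apply_symm_apply]
  · rw [inner_mulL_right]
    simp only [LinearIsometryEquiv.apply_symm_apply]
    refine integral_congr_ae ?_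
    filter_upwards [coeFn_besselL hs0 φ, coeFn_besselL hs0 ψ] with η h1 h2
    have h0 := weight_pos' η
    have e : weight η ^ (-s) * weight η ^ (-s) = (weight η)⁻¹ := by
      rw [← Real.rpow_add h0, ← Real.rpow_neg_one, hs]
      norm_num
    rw [h1, h2, map_mul, Complex.conj_ofReal, div_eq_mul_inv, ← e]
    push_cast
    ring

end Prandtl

end

theorem theorem3p5 (V : ℝ → ℝ) (M : ℝ)
    (hVm : AEMeasurable V (volume.restrict (Set.Ioo (-1 : ℝ) 1)))
    (hV0 : ∀ᵐ x ∂(volume.restrict (Set.Ioo (-1 : ℝ) 1)), 0 ≤ V x)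
    (hVM : ∀ᵐ x ∂(volume.restrict (Set.Ioo (-1 : ℝ) 1)), (1 - x ^ 2) * V x ≤ M)
    (θ : ℝ) (hθ0 : 0 ≤ θ) (hθ1 : θ ≤ 1 / 2)
    (f : Prandtl.HTilde (1 / 2 - θ) →ₗ⋆[ℂ] ℂ) (hf : Prandtl.MemDual f) :
    ∃ u : Prandtl.LTilde,
      Prandtl.IsWeakSolution V (Prandtl.restrictDual (sub_le_self (1 / 2) hθ0) f) u ∧
      (∀ v : Prandtl.LTilde,
        Prandtl.IsWeakSolution V (Prandtl.restrictDual (sub_le_self (1 / 2) hθ0) f) v → v = u) ∧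
      u ∈ Prandtl.HTilde (1 / 2 + θ) ∧
      Prandtl.normHTilde (1 / 2 + θ) u
        ≤ Real.pi ^ (1 - 2 * θ) * Prandtl.constC2 M ^ θ * Prandtl.dualNorm f := by
  open Prandtl in
  have hhalf : (0 : ℝ) ≤ 1 / 2 := by norm_num
  have hσ : 0 ≤ 1 / 2 - θ := by linarith
  have hpi := Real.pi_pos
  have hV := memLp_potential hVm hV0 hVM
  have hW0 : ∀ᵐ x ∂muTilde, 0 ≤ (1 - x ^ 2) * V x := by
    filter_upwards [ae_muTilde_of_ae hV0, ae_muTilde_mem] with x h1 h2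
    exact mul_nonneg (by nlinarith [h2.1, h2.2]) h1
  -- `(-1,1)` has positive measure, so the two bounds on `V` are compatible only if `0 ≤ M`
  have hM : 0 ≤ M := by
    have : (volume.restrict (Set.Ioo (-1 : ℝ) 1)) ≠ 0 := by
      rw [Ne, Measure.restrict_eq_zero, Real.volume_Ioo]
      norm_num
    have := ae_neBot.2 this
    obtain ⟨x, h1, h2, h3⟩ := (hV0.and (hVM.and (ae_restrict_mem measurableSet_Ioo))).exists
    exact (mul_nonneg (by nlinarith [h3.1, h3.2]) h1).trans h2
  have hin : ∀ u, inner ℂ (potentialL V hV u) u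
      = inner ℂ (mulL _ hV (transformU.symm u)) (transformU.symm u) := fun u => by
    rw [potentialL_apply, ← LinearIsometryEquiv.inner_map_map transformU (mulL _ hV _),
      LinearIsometryEquiv.apply_symm_apply]
  obtain ⟨S, hS, hSb⟩ := exists_solution_operator (μ := volume) measurable_weight one_le_weight
    (κ := 1 / Real.pi) (by positivity) (symbol_bounds.mono fun _ h => h.1) memLp_symbol_div_weight
    (potentialL V hV) hM
    (fun u => by
      rw [hin]
      simpa using mul_norm_sq_le_re_inner_mulL hV hW0 (transformU.symm u))
    (fun u => by
      rw [hin, potentialL_apply, LinearIsometryEquiv.norm_map]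
      exact norm_mulL_sq_le hV hW0 (ae_muTilde_of_ae hVM) _)
    (memLp_rpow_neg measurable_weight one_le_weight hhalf)
  obtain ⟨F, hFn, hF⟩ := exists_riesz hσ hf
  -- `(f, g) = ⟨ψ, besselL θ F⟩` for `g` with coordinate `ψ`, since `½ = (½ - θ) + θ`
  have hweak : ∀ φ, IsWeakSolution V (restrictDual (sub_le_self (1 / 2) hθ0) f)
      (transformU.symm (besselL (1 / 2) hhalf φ)) ↔ φ = S (besselL θ hθ0 F) := by
    intro φ
    have hfv : ∀ ψ, restrictDual (sub_le_self (1 / 2) hθ0) f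
        ⟨transformU.symm (besselL (1 / 2) hhalf ψ), symm_besselL_mem hhalf ψ⟩
          = inner ℂ ψ (besselL θ hθ0 F) := by
      intro ψ
      have h1 : inner ℂ (besselL θ hθ0 ψ) F = inner ℂ ψ (besselL θ hθ0 F) := inner_mulL_left _ _ _
      rw [← h1, ← hF]
      refine congrArg f (Subtype.ext ?_)
      have h2 := besselL_besselL hσ hθ0 ψ
      have h3 : besselL (1 / 2) hhalf ψ = besselL (1 / 2 - θ + θ) (add_nonneg hσ hθ0) ψ := by
        congr 2
        ring
      exact congrArg transformU.symm (h3.trans h2.symm)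
    rw [← hS]
    constructor
    · rintro ⟨_, h⟩
      refine ext_inner_left ℂ fun ψ => ?_
      rw [← hfv, ← h]
      exact (form_symm_besselL hV rfl hhalf φ ψ).symm
    · intro h
      refine ⟨symm_besselL_mem hhalf φ, fun g => ?_⟩
      obtain ⟨ψ, hψ⟩ := exists_eq_symm_besselL hhalf g.2
      have hg : g = ⟨transformU.symm (besselL (1 / 2) hhalf ψ), symm_besselL_mem hhalf ψ⟩ :=
        Subtype.ext hψ
      rw [hg, hfv, ← h]
      exact form_symm_besselL hV rfl hhalf φ ψ
  have hen : energy (1 / 2 + θ) (besselL (1 / 2) hhalf (S (besselL θ hθ0 F)))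
      ≤ ENNReal.ofReal ((Real.pi ^ (1 - 2 * θ) * constC2 M ^ θ * ‖F‖) ^ 2) := by
    have hC : 0 < constC2 M := by unfold constC2; positivity
    have h1 := hSb (2 * θ) (by linarith) (by linarith) (besselL θ hθ0 F) F (by
      filter_upwards [coeFn_besselL hθ0 F] with η h
      rw [h]
      congr 3
      ring)
    rw [energy_besselL]
    convert! h1 using 2
    · ext η
      congr 3
      ring
    · have e : (1 / Real.pi)⁻¹ ^ 2 * (2 + M / (2 * (1 / Real.pi))) = constC2 M := by
        rw [constC2]; field_simp
      rw [e, mul_pow, mul_pow, one_div, inv_inv, ← Real.rpow_mul_natCast hpi.le,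
        ← Real.rpow_mul_natCast hC.le, ← Real.rpow_natCast Real.pi 2, ← Real.rpow_mul hpi.le]
      congr 3 <;> push_cast <;> ring
  refine ⟨transformU.symm (besselL (1 / 2) hhalf (S (besselL θ hθ0 F))),
    (hweak _).2 rfl, ?_, ?_, ?_⟩
  · intro v hv
    obtain ⟨φ, rfl⟩ := exists_eq_symm_besselL hhalf hv.1
    rw [(hweak φ).1 hv]
  · rw [mem_HTilde_iff, LinearIsometryEquiv.apply_symm_apply]
    exact (hen.trans_lt ENNReal.ofReal_lt_top).ne
  · have hC : 0 < constC2 M := by unfold constC2; positivity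
    rw [normHTilde_eq, LinearIsometryEquiv.apply_symm_apply]
    refine (Real.sqrt_le_left (by have := dualNorm_nonneg f; positivity)).2 ?_
    refine (ENNReal.toReal_le_of_le_ofReal (by positivity) hen).trans ?_
    gcongr
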